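/- Let $d\ge 3$, let $\Omega$ be a set with $d$ elements, and let $T_d$ be a $d$-regular tree with vertex set $V_d$, whose edges are colored by $\Omega$ so that around every vertex the coloring is a bijection between the star of that vertex and $\Omega$. For $g\in\mathrm{Aut}(T_d)$ and $v\in V_d$ let $\sigma(g,v)\in\mathrm{Sym}(\Omega)$ be the permutation of the colors induced by the map $g$ from the star of $v$ to the star of $gv$. For $F\le F'\le\mathrm{Sym}(\Omega)$ let $G(F,F')$ be the group of all $g\in\mathrm{Aut}(T_d)$ such that $\sigma(g,v)\in F'$ for all $v$ and $\sigma(g,v)\in F$ for all but finitely many $v$, and let $G(F,F')^\ast$ be its subgroup of elements preserving each class of the bipartition of $T_d$. For a group $B$, a subgroup $A\le B$ and a group $H$ acting on a set $X$, let $B\wr_X^A H=B^{X,A}\rtimes H$, where $B^{X,A}$ is the group of functions $f:X\to B$ with $f(x)\in A$ for all but finitely many $x$, and $(hf)(x)=f(h^{-1}x)$; write $B\wr_X H$ when $A=1$, and $B\wr H$ when moreover $X=H$ with the left translation action. Let $\mathfrak S_n$ be the group of permutations of $\{0,\dots,n-1\}$, $\mathfrak S_{n-1}\le\mathfrak S_n$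 the stabilizer of $0$, and $G_{n,d}=\mathfrak S_n\wr_{V_d}^{\mathfrak S_{n-1}}\mathrm{Aut}(T_d)$, with the group topology for which $\mathfrak S_{n-1}^{V_d}\rtimes\mathrm{Aut}(T_d)$ is open and carries the product topology (where $\mathrm{Aut}(T_d)$ has the topology of pointwise convergence). A lattice (discrete subgroup of finite covolume) in $B\wr_X^A H$ is irreducible if its projection to $H$ is not discrete. Let $\mathcal C_{n,d}$ be the lamplighter graph: its vertices are the pairs $(f,v)$ with $f:V_d\to\{0,\dots,n-1\}$ finitely supported and $v\in V_d$; $(f,v)$ and $(f',v')$ are adjacent if and only if either $f=f'$ and $v,v'$ are adjacent in $T_d$, or $v=v'$ and $f,f'$ differ exactly at $v$. **Theorem.** Let $F\lneq F'\le\mathrm{Sym}(\Omega)$ be such that $F$ is semi-regular (all point stabilizers are trivial) and $F'$ preserves the orbits of $F$, and let $n=[F':F]$. (a) Identify $F'/F$ with $\{0,\dots,n-1\}$ by any bijection that sends the coset $F$ to $0$, and let $\alpha:F'\to\mathfrak S_n$ be the resulting action of $F'$ on $F'/F$. Then $\gamma\mapsto\varphi(\gamma)=\big((\alpha(\sigma(\gamma,\gamma^{-1}v)))_{v\in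 V_d},\gamma\big)$ is an injective homomorphism $G(F,F')\to G_{n,d}$ whose image is an irreducible cocompact lattice in $G_{n,d}$. Moreover $\gamma\cdot(f,v)=(f^\gamma,\gamma v)$, with $f^\gamma(w)=\alpha(\sigma(\gamma,\gamma^{-1}w))\cdot f(\gamma^{-1}w)$, is an action of $G(F,F')$ on $\mathcal C_{n,d}$ by graph automorphisms that is proper (for any two vertices, only finitely many elements map the first to the second) and cocompact (finitely many orbits of vertices and edges). (b) Let $\Gamma_{n,d}=C_n\wr_{V}(C_d\ast C_d)$, where $C_m$ denotes the cyclic group of order $m$ and $V$ is the vertex set of the Bass--Serre tree of $C_d\ast C_d$ (a copy of $T_d$). If $F$ is regular (transitive and semi-regular), then $\Gamma_{n,d}$ and $G(F,F')^\ast$ have isometric Cayley graphs: they admit finite generating sets whose Cayley graphs are isomorphic. Moreover $\Gamma_{n,d}$ is isomorphic to a semi-direct product $(C_n^2\wr\mathbb F_{d-1})\rtimes C_d$, where $\mathbb F_{d-1}$ is the free group of rank $d-1$. -/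

import Mathlib

open scoped RestrictedProduct

/-! ### Permutation groups -/

/-- A permutation group is semi-regular if all its point stabilizers are trivial. -/
def IsSemiregularPermGroup {Ω : Type*} (F : Subgroup (Equiv.Perm Ω)) : Prop :=
  ∀ a : Ω, MulAction.stabilizer F a = ⊥

/-- A permutation group is regular if it is transitive and semi-regular. -/
def IsRegularPermGroup {Ω : Type*} (F : Subgroup (Equiv.Perm Ω)) : Prop :=
  MulAction.IsPretransitive F Ω ∧ IsSemiregularPermGroup F

/-- `F'` preserves every orbit of `F` on `Ω`. -/
def PreservesOrbitsOf {Ω : Type*} (F' F : Subgroup (Equiv.Perm Ω)) : Prop :=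
  ∀ s ∈ F', ∀ a : Ω, s a ∈ MulAction.orbit F a

/-! ### Automorphisms of graphs, edge colorings and local permutations -/

/-- The topology of pointwise convergence on the automorphism group of a graph (the set of
vertices being discrete): the pointwise stabilizers of finite sets of vertices form a basis of
neighbourhoods of the identity. -/
instance graphAutTopology {V : Type*} (T : SimpleGraph V) : TopologicalSpace (T ≃g T) :=
  TopologicalSpace.induced (fun g : T ≃g T => (g : V → V))
    (@Pi.topologicalSpace V (fun _ => V) (fun _ => ⊥))

/-- A coloring of the edges of `T` by `Ω` which, around every vertex `v`, restricts to a bijection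
between the star around `v` (whose edges are parametrized by the neighbours of `v`) and `Ω`.
In particular `T` is then regular of degree the cardinality of `Ω`. -/
structure LegalColoring {V : Type*} (T : SimpleGraph V) (Ω : Type*) where
  /-- the color of an edge -/
  color : T.edgeSet → Ω
  /-- the coloring is bijective on every star -/
  bijective_star : ∀ v : V,
    Function.Bijective (fun w : T.neighborSet v => color ⟨s(v, w.1), w.2⟩)

namespace LegalColoring

variable {V Ω : Type*} {T : SimpleGraph V} (c : LegalColoring T Ω)

/-- The bijection between the star around `v` and the set of colors. -/
noncomputable def starEquiv (v : V) : T.neighborSet v ≃ Ω :=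
  Equiv.ofBijective _ (c.bijective_star v)

/-- The local permutation `σ(g, v)` of an automorphism `g` at a vertex `v`: the permutation of the
colors induced by the map from the star around `v` to the star around `g v`. -/
noncomputable def localPerm (g : T ≃g T) (v : V) : Equiv.Perm Ω :=
  (c.starEquiv v).symm.trans ((g.mapNeighborSet v).trans (c.starEquiv (g v)))

theorem localPerm_one (v : V) : c.localPerm 1 v = 1 := by
  ext a
  exact (c.starEquiv v).apply_symm_apply a

theorem localPerm_mul (g h : T ≃g T) (v : V) :
    c.localPerm (g * h) v = c.localPerm g (h v) * c.localPerm h v := by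
  ext a
  simp only [localPerm, Equiv.trans_apply, Equiv.Perm.mul_apply, Equiv.symm_apply_apply]
  rfl

theorem localPerm_inv (g : T ≃g T) (v : V) :
    c.localPerm g⁻¹ v = (c.localPerm g (g⁻¹ v))⁻¹ := by
  have h := c.localPerm_mul g g⁻¹ v
  rw [mul_inv_cancel, localPerm_one] at h
  exact (inv_eq_of_mul_eq_one_right h.symm).symm

/-- The group `G(F, F')` of automorphisms whose local permutations belong to `F'` at all
vertices and belong to `F` at all but finitely many vertices. -/
def almostPrescribed (F F' : Subgroup (Equiv.Perm Ω)) : Subgroup (T ≃g T) where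
  carrier := {g | (∀ v, c.localPerm g v ∈ F') ∧ {v | c.localPerm g v ∉ F}.Finite}
  one_mem' := by simp [localPerm_one, one_mem]
  mul_mem' := by
    rintro g h ⟨hg, hgf⟩ ⟨hh, hhf⟩
    refine ⟨fun v => ?_, ?_⟩
    · rw [localPerm_mul]
      exact mul_mem (hg _) (hh _)
    · refine ((hgf.preimage (f := h) h.injective.injOn).union hhf).subset fun v hv => ?_
      by_contra hcon
      simp only [Set.mem_union, Set.mem_preimage, Set.mem_ofPred_eq, not_or, not_not] at hcon
      apply hv
      rw [localPerm_mul]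
      exact mul_mem hcon.1 hcon.2
  inv_mem' := by
    rintro g ⟨hg, hgf⟩
    refine ⟨fun v => ?_, ?_⟩
    · rw [localPerm_inv]
      exact inv_mem (hg _)
    · refine (hgf.preimage (f := (g⁻¹ : T ≃g T)) (g⁻¹ : T ≃g T).injective.injOn).subset
        fun v hv => ?_
      intro hcon
      apply hv
      rw [localPerm_inv]
      exact inv_mem hcon

end LegalColoring

/-- The group of automorphisms of a graph that preserve its bipartitions, i.e. that map every
vertex to a vertex of the same class for every proper coloring of the vertices with two colors (a
tree has exactly one such coloring, up to exchanging the two colors). -/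
def bipartitionPreserving {V : Type*} (T : SimpleGraph V) : Subgroup (T ≃g T) where
  carrier := {g | ∀ (C : T.Coloring Bool) (v : V), C (g v) = C v}
  one_mem' := fun _ _ => rfl
  mul_mem' := by
    intro g h hg hh C v
    exact (hg C (h v)).trans (hh C v)
  inv_mem' := by
    intro g hg C v
    have h := hg C (g⁻¹ v)
    rwa [show g (g⁻¹ v) = v from g.apply_symm_apply v, eq_comm] at h

/-- The subgroup `G(F, F')*` of the elements of `G(F, F')` that preserve the bipartition. -/
def LegalColoring.almostPrescribedStar {V Ω : Type*} {T : SimpleGraph V}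
    (c : LegalColoring T Ω) (F F' : Subgroup (Equiv.Perm Ω)) : Subgroup (T ≃g T) :=
  c.almostPrescribed F F' ⊓ bipartitionPreserving T

/-! ### Semi-restricted permutational wreath products -/

/-- The action of `H` on the group `B^{X,A}` of functions `f : X → B` with `f x ∈ A` for all but
finitely many `x`, given by `(h f)(x) = f(h⁻¹ x)`. -/
def wreathAction {B : Type*} [Group B] (A : Subgroup B) (X H : Type*) [Group H] [MulAction H X] :
    H →* MulAut (Πʳ _ : X, [B, A]) where
  toFun h :=
    { toFun := fun f => ⟨fun x => f (h⁻¹ • x),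
        (MulAction.injective h⁻¹).tendsto_cofinite.eventually f.2⟩
      invFun := fun f => ⟨fun x => f (h • x),
        (MulAction.injective h).tendsto_cofinite.eventually f.2⟩
      left_inv := fun f => by ext x; simp
      right_inv := fun f => by ext x; simp
      map_mul' := fun _ _ => rfl }
  map_one' := by
    ext f x
    exact congrArg f (by simp)
  map_mul' h k := by
    ext f x
    exact congrArg f (by simp [mul_smul])

/-- The semi-restricted permutational wreath product `B ≀_X^A H`, that is the semi-direct
product of `B^{X,A}` by `H`. -/
abbrev SemiWreath {B : Type*} [Group B] (A : Subgroup B) (X H : Type*) [Group H]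
    [MulAction H X] : Type _ :=
  (Πʳ _ : X, [B, A]) ⋊[wreathAction A X H] H

/-- The restricted permutational wreath product `B ≀_X H`. -/
abbrev RestrictedWreath (B X H : Type*) [Group B] [Group H] [MulAction H X] : Type _ :=
  SemiWreath (⊥ : Subgroup B) X H

/-- The topology of `B ≀_X^A H` is the product topology of `B^{X,A}` and `H`, where `B^{X,A}`
has the topology of a restricted product; when `A` is open in `B`, the latter is the group
topology for which `A^X`, with the product topology, is an open subgroup. -/
instance semiWreathTopology {B : Type*} [Group B] [TopologicalSpace B] (A : Subgroup B)
    (X H : Type*) [Group H] [TopologicalSpace H] [MulAction H X] :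
    TopologicalSpace (SemiWreath A X H) :=
  TopologicalSpace.induced (fun g : SemiWreath A X H => (g.left, g.right)) inferInstance

/-- The finite symmetric groups are discrete. -/
instance symmetricGroupTopology (n : ℕ) : TopologicalSpace (Equiv.Perm (Fin n)) := ⊥

/-- The group `𝔖_n ≀_V^{𝔖_{n-1}} Aut(T)`, where `V` is the set of vertices of `T`, and where
`𝔖_{n-1}` is the stabilizer of `0` in the group `𝔖_n` of permutations of `{0, …, n-1}`. -/
abbrev LampGroup (n : ℕ) [NeZero n] {V : Type*} (T : SimpleGraph V) : Type _ :=
  SemiWreath (MulAction.stabilizer (Equiv.Perm (Fin n)) (0 : Fin n)) V (T ≃g T)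

/-! ### Lattices -/

/-- A subgroup `Γ` of a topological group `G` is a lattice if it is discrete and if `G ⧸ Γ`
carries a non-zero finite Borel measure invariant under `G`. -/
def IsLatticeSubgroup {G : Type*} [Group G] [TopologicalSpace G] (Γ : Subgroup G) : Prop :=
  DiscreteTopology Γ ∧
    ∃ μ : @MeasureTheory.Measure (G ⧸ Γ) (borel (G ⧸ Γ)),
      μ Set.univ ≠ 0 ∧ μ Set.univ ≠ ⊤ ∧
        ∀ (g : G) (E : Set (G ⧸ Γ)), @MeasurableSet _ (borel (G ⧸ Γ)) E →
          μ ((fun x => g • x) ⁻¹' E) = μ E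

/-- A cocompact lattice. -/
def IsCocompactLattice {G : Type*} [Group G] [TopologicalSpace G] (Γ : Subgroup G) : Prop :=
  IsLatticeSubgroup Γ ∧ CompactSpace (G ⧸ Γ)

/-- A lattice in a wreath product `B ≀_X^A H` is irreducible if its projection to `H` is not
discrete. -/
def IsIrreducibleInWreath {B : Type*} [Group B] {A : Subgroup B} {X H : Type*} [Group H]
    [TopologicalSpace H] [MulAction H X] (Γ : Subgroup (SemiWreath A X H)) : Prop :=
  ¬ DiscreteTopology (Γ.map SemidirectProduct.rightHom : Subgroup H)

/-! ### The twisting cocycle -/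

/-- The morphism `α : F' → 𝔖_n` given by the action of `F'` on the coset space `F' / F`, where
the latter is identified with `{0, …, n-1}` by means of `e`. -/
def cosetHom {Ω : Type*} {F F' : Subgroup (Equiv.Perm Ω)} {n : ℕ}
    (e : (F' ⧸ F.subgroupOf F') ≃ Fin n) : F' →* Equiv.Perm (Fin n) :=
  (Equiv.permCongrHom e).toMonoidHom.comp (MulAction.toPermHom F' (F' ⧸ F.subgroupOf F'))

/-- The cocycle `ρ_{γ,v} = α(σ(γ, γ⁻¹ v))`. -/
noncomputable def LegalColoring.cocycle {V Ω : Type*} {T : SimpleGraph V}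
    (c : LegalColoring T Ω) {F F' : Subgroup (Equiv.Perm Ω)} {n : ℕ}
    (e : (F' ⧸ F.subgroupOf F') ≃ Fin n) (γ : c.almostPrescribed F F') (v : V) :
    Equiv.Perm (Fin n) :=
  cosetHom e ⟨c.localPerm γ.1 (γ.1⁻¹ v), γ.2.1 _⟩

/-! ### The lamplighter graph and actions on graphs -/

/-- The lamplighter graph over `T` with `n` states: the wreath product of the complete graph on
`{0, …, n-1}` with `T`. The vertices are the pairs `(f, v)` with `f : V → {0, …, n-1}` finitely
supported and `v` a vertex of `T`; an edge either moves `v` to a neighbour without changing `f`, or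
changes the value of `f` at the point `v` only. -/
def lamplighterGraph (n : ℕ) [NeZero n] {V : Type*} (T : SimpleGraph V) :
    SimpleGraph ((V →₀ Fin n) × V) where
  Adj x y := (x.1 = y.1 ∧ T.Adj x.2 y.2) ∨ (x.2 = y.2 ∧ ∀ w, x.1 w = y.1 w ↔ w ≠ x.2)
  symm := by
    constructor
    rintro ⟨f, v⟩ ⟨f', v'⟩ (⟨h, h'⟩ | ⟨h, h'⟩)
    · exact Or.inl ⟨h.symm, h'.symm⟩
    · simp only at h h'
      subst h
      exact Or.inr ⟨rfl, fun w => by rw [eq_comm]; exact h' w⟩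
  loopless := by
    constructor
    rintro ⟨f, v⟩ (⟨_, h⟩ | ⟨_, h⟩)
    · exact h.ne rfl
    · exact (h v).1 rfl rfl

/-- An action of a (discrete) group on a graph is proper if for any two vertices, only finitely
many group elements map the first one to the second one. -/
def IsProperGraphAction {Γ W : Type*} [Group Γ] {X : SimpleGraph W} (ψ : Γ →* (X ≃g X)) : Prop :=
  ∀ x y : W, {γ : Γ | ψ γ x = y}.Finite

/-- An action of a group on a graph is cocompact if there are only finitely many orbits of
vertices and finitely many orbits of edges, i.e. finitely many vertices, resp. edges, whose
translates cover the graph. -/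
def IsCocompactGraphAction {Γ W : Type*} [Group Γ] {X : SimpleGraph W} (ψ : Γ →* (X ≃g X)) :
    Prop :=
  (∃ K : Set W, K.Finite ∧ ∀ x : W, ∃ γ : Γ, ψ γ x ∈ K) ∧
    ∃ E : Set (Sym2 W), E.Finite ∧ ∀ a ∈ X.edgeSet, ∃ γ : Γ, Sym2.map (ψ γ) a ∈ E

/-! ### Cayley graphs and the group `C_n ≀_V (C_d * C_d)` -/

/-- Two groups have isometric Cayley graphs if they have finite generating sets whose associated
Cayley graphs are isomorphic as (unlabelled) graphs, equivalently, isometric for the graph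
distance. -/
def HaveIsometricCayleyGraphs (G H : Type*) [Group G] [Group H] : Prop :=
  ∃ (S : Set G) (R : Set H), S.Finite ∧ R.Finite ∧
    Subgroup.closure S = ⊤ ∧ Subgroup.closure R = ⊤ ∧
      Nonempty (SimpleGraph.mulCayley S ≃g SimpleGraph.mulCayley R)

/-- The cyclic group of order `m` (for `m ≥ 1`), written multiplicatively. -/
abbrev CyclicGrp (m : ℕ) : Type := Multiplicative (ZMod m)

/-- The free product `C_d * C_d`. -/
abbrev CyclicFreeProduct (d : ℕ) : Type := Monoid.Coprod (CyclicGrp d) (CyclicGrp d)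

/-- The set of vertices of the Bass-Serre tree of `C_d * C_d`: the disjoint union of the coset
spaces of the two free factors. -/
abbrev BassSerreVertex (d : ℕ) : Type :=
  (CyclicFreeProduct d ⧸ (Monoid.Coprod.inl : CyclicGrp d →* CyclicFreeProduct d).range) ⊕
    (CyclicFreeProduct d ⧸ (Monoid.Coprod.inr : CyclicGrp d →* CyclicFreeProduct d).range)

/-- The group `Γ_{n,d} = C_n ≀_V (C_d * C_d)`, where `V` is the set of vertices of the Bass-Serre
tree of `C_d * C_d`. -/
abbrev LampCyclicGroup (n d : ℕ) : Type :=
  RestrictedWreath (CyclicGrp n) (BassSerreVertex d) (CyclicFreeProduct d)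

/-- The (standard, restricted) wreath product `C_n² ≀ 𝔽_k`, where `𝔽_k` is the free group of rank
`k`, acting on itself by left translations. -/
abbrev LampFreeGroup (n k : ℕ) : Type :=
  RestrictedWreath (CyclicGrp n × CyclicGrp n) (FreeGroup (Fin k)) (FreeGroup (Fin k))

/-!
# Lattices in wreath products acting on the lamplighter graph

Everything rests on one construction, `LegalColoring.exists_aut`: on a tree with a legal edge
coloring, local permutations may be chosen freely, vertex after vertex away from a root, subject
only to agreeing on the color of the edge just crossed. Since `F'` preserves the orbits of `F`, an
element of `F'` can be prescribed on one color and, independently, by its action on `F' ⧸ F`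
(`exists_cosetHom_eq`). Hence `G(F, F')`, acting on lamp configurations through the cocycle, maps
any pair (finitely supported configuration, vertex) to any other one
(`LegalColoring.exists_almostPrescribed`). Conversely an element of the stabilizer of `(0, v)` has
all its local permutations in `F`, and semi-regularity of `F` makes it determined by its local
permutation at `v`, so that stabilizers are finite. This gives the proper and cocompact action on
the lamplighter graph.

For the lattice, let `O` be the stabilizer of a vertex of the lamplighter graph in the ambient
wreath product `G`. It is a compact open subgroup, `G = O Γ` by transitivity and `O ∩ Γ` is finite, so `Γ`
is discrete and `G ⧸ Γ` is compact. The invariant measure is the image of the restriction to `O` of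
a Haar measure of `G`; its invariance under `G` is proved together with the unimodularity of `G`, by
cutting a left coset of `O` along the right translates `O γ` (`measure_inter_coset`). That `G` is a
topological group is seen by recognizing its topology as the topology of pointwise convergence on
the vertices of the lamplighter graph (`isInducing_lampProdPerm`). The projection of `Γ` to `Aut(T)`
is not discrete, because its intersection with the compact stabilizer of a vertex still acts
transitively on the infinite set of configurations.

When `F` is regular, `G(F, F')*` acts simply transitively on the pairs (configuration, edge of `T`).
The group `C_d * C_d` acts on the same tree `T`, its two factors acting by rotations around the two
ends of an edge. By ping-pong on the two half-trees this action is faithful, it is simply transitive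
on the edges, and it identifies `T` with the Bass-Serre tree; so `C_n ≀ (C_d * C_d)` also acts
simply transitively on these pairs. Both actions preserve the locally finite connected graph
`lampEdgeGraph n T`, which is therefore a Cayley graph of both groups.

Finally the kernel of the fold map `C_d * C_d → C_d` is free on the elements `a₁ a₂⁻¹`, `a ≠ 1`,
where `a₁` and `a₂` are the two copies of `a`, and it acts simply transitively on both classes of vertices
of the Bass-Serre tree. Thus the wreath product over this kernel is `C_n² ≀ 𝔽_{d-1}`, and the fold
map is split by the first factor.
-/

/-! ### Building tree automorphisms from local data -/

/-- Transport of a value backwards along a walk, one edge at a time. -/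
def SimpleGraph.Walk.transport {V : Type*} {T : SimpleGraph V} {X : V → Type*}
    (step : ∀ {w u : V}, T.Adj w u → X u → X w) : ∀ {w v : V}, T.Walk w v → X v → X w
  | _, _, .nil, x => x
  | _, _, .cons h p, x => step h (p.transport step x)

/-- In a tree, for two adjacent vertices, the path from one of them to the root passes through
the other one. -/
theorem SimpleGraph.IsTree.path_cons_or {V : Type*} {T : SimpleGraph V} (hT : T.IsTree) {v u w : V}
    (h : T.Adj w u) {p : T.Walk w v} {q : T.Walk u v} (hp : p.IsPath) (hq : q.IsPath) :
    p = .cons h q ∨ q = .cons h.symm p := by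
  by_cases hu : u ∈ p.support
  · left
    have h3 : w ∉ q.support := by
      have := hT.isAcyclic.ne_mem_support_of_support_of_adj_of_isPath hp.reverse hq.reverse h
        (by simpa using hu)
      simpa using this
    exact (hT.existsUnique_path w v).unique hp (hq.cons h3)
  · right
    exact (hT.existsUnique_path u v).unique hq (hp.cons hu)

namespace LegalColoring

variable {V Ω : Type*} {T : SimpleGraph V} (c : LegalColoring T Ω)

/-- The neighbour of `w` along the edge with color `a`. -/
noncomputable def nbr (w : V) (a : Ω) : V := ((c.starEquiv w).symm a).1

theorem adj_nbr (w : V) (a : Ω) : T.Adj w (c.nbr w a) := ((c.starEquiv w).symm a).2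

theorem nbr_eq_iff {w u : V} (h : T.Adj w u) (a : Ω) :
    c.nbr w a = u ↔ c.color ⟨s(w, u), h⟩ = a := by
  have : c.color ⟨s(w, u), h⟩ = c.starEquiv w ⟨u, h⟩ := rfl
  rw [this, ← Equiv.eq_symm_apply, nbr, Subtype.ext_iff, eq_comm]

theorem exists_nbr_eq {w u : V} (h : T.Adj w u) : ∃ a, c.nbr w a = u :=
  ⟨_, (c.nbr_eq_iff h _).2 rfl⟩

theorem nbr_injective (w : V) : Function.Injective (c.nbr w) :=
  Subtype.val_injective.comp (c.starEquiv w).symm.injective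

theorem nbr_nbr (w : V) (a : Ω) : c.nbr (c.nbr w a) a = w := by
  rw [c.nbr_eq_iff (c.adj_nbr w a).symm]
  have h := (c.nbr_eq_iff (c.adj_nbr w a) a).1 rfl
  refine Eq.trans ?_ h
  congr 2
  exact Sym2.eq_swap

theorem map_nbr (g : T ≃g T) (w : V) (a : Ω) :
    g (c.nbr w a) = c.nbr (g w) (c.localPerm g w a) := by
  simp only [nbr, localPerm, Equiv.trans_apply, Equiv.symm_apply_apply]
  rfl

theorem localPerm_eq_of {g : T ≃g T} {w : V} {p : Equiv.Perm Ω}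
    (h : ∀ a, g (c.nbr w a) = c.nbr (g w) (p a)) : c.localPerm g w = p := by
  ext a
  apply c.nbr_injective (g w)
  rw [← h, map_nbr]

theorem localPerm_nbr (g : T ≃g T) (w : V) (a : Ω) :
    c.localPerm g (c.nbr w a) a = c.localPerm g w a := by
  apply c.nbr_injective (g (c.nbr w a))
  rw [← map_nbr, nbr_nbr, map_nbr, nbr_nbr]

/-- Induction along the edges of a connected graph with a legal coloring. -/
theorem nbr_induction (hT : T.Connected) {P : V → Prop} {v : V} (h0 : P v)
    (h : ∀ w a, P w → P (c.nbr w a)) (w : V) : P w := by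
  obtain ⟨p⟩ := hT.preconnected w v
  induction p with
  | nil => exact h0
  | cons hadj _ ih =>
    obtain ⟨a, ha⟩ := c.exists_nbr_eq hadj.symm
    exact ha ▸ h _ a (ih h0)

/-- Development of local data along the tree: if `R w y p` reads "a map may send `w` to `y` with
local permutation `p`", and if every admissible choice at `w` extends to the neighbours of `w`, then
there is a global map all of whose local data are admissible. -/
theorem exists_local_map (hT : T.IsTree) {R : V → V → Equiv.Perm Ω → Prop}
    (hR : ∀ w y p, R w y p → ∀ a, ∃ q, R (c.nbr w a) (c.nbr y (p a)) q ∧ q a = p a)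
    {v v' : V} {s : Equiv.Perm Ω} (h0 : R v v' s) :
    ∃ (g : V → V) (σ : V → Equiv.Perm Ω), g v = v' ∧ σ v = s ∧ (∀ w, R w (g w) (σ w)) ∧
      ∀ w a, g (c.nbr w a) = c.nbr (g w) (σ w a) := by
  -- One step: the value at `u` is extended to its neighbour `w`, along the color of the edge `uw`.
  have hstep : ∀ {w u : V} (h : T.Adj w u) (x : {x : V × Equiv.Perm Ω // R u x.1 x.2}),
      ∃ x' : {x : V × Equiv.Perm Ω // R w x.1 x.2}, ∀ a, c.nbr u a = w →
        x'.1.1 = c.nbr x.1.1 (x.1.2 a) ∧ x'.1.2 a = x.1.2 a := by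
    rintro w u h ⟨⟨y, p⟩, hx⟩
    obtain ⟨a, rfl⟩ := c.exists_nbr_eq h.symm
    obtain ⟨q, hq, hqa⟩ := hR _ _ _ hx a
    refine ⟨⟨(_, q), hq⟩, fun b hb => ?_⟩
    rw [c.nbr_injective u hb]
    exact ⟨rfl, hqa⟩
  choose step hstep using @hstep
  choose path hpath using fun w => (hT.existsUnique_path w v).exists
  let D : ∀ w, {x : V × Equiv.Perm Ω // R w x.1 x.2} := fun w =>
    (path w).transport (fun h x => step h x) ⟨(v', s), h0⟩
  have hv : D v = ⟨(v', s), h0⟩ := by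
    have : path v = .nil := (hT.existsUnique_path v v).unique (hpath v) .nil
    simp only [D, this]
    rfl
  have hcons : ∀ {w u : V} (h : T.Adj w u), path w = .cons h (path u) → D w = step h (D u) := by
    intro w u h hw
    simp only [D, hw]
    rfl
  refine ⟨fun w => (D w).1.1, fun w => (D w).1.2, by simp [hv], by simp [hv],
    fun w => (D w).2, fun w a => ?_⟩
  -- Either end of the edge can be the one closer to the root `v`.
  have hadj := c.adj_nbr w a
  rcases hT.path_cons_or hadj (hpath w) (hpath _) with h | h
  · obtain ⟨h1, h2⟩ := hstep hadj (D (c.nbr w a)) a (c.nbr_nbr w a)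
    rw [← hcons hadj h] at h1 h2
    beta_reduce
    rw [h1, h2, nbr_nbr]
  · obtain ⟨h1, -⟩ := hstep hadj.symm (D w) a rfl
    rwa [← hcons hadj.symm h] at h1

/-- A map which permutes stars according to local permutations is a covering of the tree by itself,
hence an automorphism: its inverse is obtained by developing the inverse local permutations. -/
theorem exists_rightInverse_of_local (hT : T.IsTree) {g : V → V} {σ : V → Equiv.Perm Ω}
    (hg : ∀ w a, g (c.nbr w a) = c.nbr (g w) (σ w a)) :
    ∃ (h : V → V) (τ : V → Equiv.Perm Ω), (∀ w, g (h w) = w) ∧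
      ∀ w a, h (c.nbr w a) = c.nbr (h w) (τ w a) := by
  obtain ⟨v⟩ := hT.connected.nonempty
  -- Admissible data for the inverse: `w` is sent to a preimage `y` of `w`, with the inverse local
  -- permutation; admissibility itself then says that the developed map is a right inverse of `g`.
  have key : ∀ w y p, (w = g y ∧ p = (σ y)⁻¹) → ∀ a, ∃ q,
      (c.nbr w a = g (c.nbr y (p a)) ∧ q = (σ (c.nbr y (p a)))⁻¹) ∧ q a = p a := by
    rintro w y p ⟨rfl, rfl⟩ a
    refine ⟨_, ⟨by rw [hg]; simp, rfl⟩, ?_⟩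
    generalize hb : (σ y)⁻¹ a = b
    have ha : a = σ y b := by simp [← hb]
    rw [Equiv.Perm.inv_eq_iff_eq, ha]
    apply c.nbr_injective (g (c.nbr y b))
    rw [← hg, nbr_nbr, hg, nbr_nbr]
  obtain ⟨h, τ, -, -, h1, h2⟩ := c.exists_local_map hT
    (R := fun w y p => w = g y ∧ p = (σ y)⁻¹) key (v := g v) (v' := v) ⟨rfl, rfl⟩
  exact ⟨h, τ, fun w => (h1 w).1.symm, h2⟩

/-- Existence of tree automorphisms with admissible local permutations. -/
theorem exists_aut (hT : T.IsTree) {R : V → V → Equiv.Perm Ω → Prop}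
    (hR : ∀ w y p, R w y p → ∀ a, ∃ q, R (c.nbr w a) (c.nbr y (p a)) q ∧ q a = p a)
    {v v' : V} {s : Equiv.Perm Ω} (h0 : R v v' s) :
    ∃ g : T ≃g T, g v = v' ∧ c.localPerm g v = s ∧ ∀ w, R w (g w) (c.localPerm g w) := by
  obtain ⟨g, σ, hv, hs, hgR, hg⟩ := c.exists_local_map hT hR h0
  obtain ⟨h, τ, hgh, hh⟩ := c.exists_rightInverse_of_local hT hg
  -- The right inverse `h` is of the same kind, so it has a right inverse too, which must be `g`.
  obtain ⟨k, -, hhk, -⟩ := c.exists_rightInverse_of_local hT hh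
  have hgk : k = g := funext fun w => by rw [← hgh (k w), hhk]
  have hadj : ∀ {f : V → V} {ρ : V → Equiv.Perm Ω},
      (∀ w a, f (c.nbr w a) = c.nbr (f w) (ρ w a)) → ∀ {w u}, T.Adj w u → T.Adj (f w) (f u) := by
    intro f ρ hf w u hwu
    obtain ⟨a, rfl⟩ := c.exists_nbr_eq hwu
    rw [hf]
    exact c.adj_nbr _ _
  let G : T ≃g T :=
    { toFun := g
      invFun := h
      left_inv := fun w => by rw [← hgk]; exact hhk w
      right_inv := hgh
      map_rel_iff' := fun {w u} => by
        refine ⟨fun H => ?_, fun H => hadj hg H⟩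
        have H' := hadj hh H
        simp only [Equiv.coe_fn_mk, ← hgk] at H'
        rwa [hhk, hhk] at H' }
  have hG : ∀ w, c.localPerm G w = σ w := fun w => c.localPerm_eq_of (hg w)
  exact ⟨G, hv, (hG v).trans hs, fun w => by rw [hG]; exact hgR w⟩

/-- An automorphism all of whose local permutations belong to a semi-regular group and which fixes a
vertex and an edge around it is trivial. -/
theorem eq_one_of_fixes (hT : T.Connected) {F : Subgroup (Equiv.Perm Ω)}
    (hF : IsSemiregularPermGroup F) {g : T ≃g T} (hg : ∀ w, c.localPerm g w ∈ F) {v : V} {a : Ω}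
    (hv : g v = v) (ha : c.localPerm g v a = a) : g = 1 := by
  have hfix : ∀ {s : Equiv.Perm Ω} {b : Ω}, s ∈ F → s b = b → s = 1 := by
    intro s b hs hb
    have : (⟨s, hs⟩ : F) ∈ MulAction.stabilizer F b := hb
    rw [hF b, Subgroup.mem_bot] at this
    exact congrArg Subtype.val this
  have key : ∀ w, g w = w ∧ c.localPerm g w = 1 :=
    c.nbr_induction hT ⟨hv, hfix (hg v) ha⟩ fun w b ⟨h1, h2⟩ =>
      ⟨by rw [map_nbr, h1, h2]; rfl,
        hfix (b := b) (hg _) (by rw [localPerm_nbr, h2]; rfl)⟩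
  ext w
  exact (key w).1

end LegalColoring

section coset

variable {Ω : Type*} {F F' : Subgroup (Equiv.Perm Ω)} {n : ℕ}
  (e : (F' ⧸ F.subgroupOf F') ≃ Fin n)

theorem cosetHom_apply_mk (s t : F') :
    cosetHom e s (e (t : F' ⧸ F.subgroupOf F')) = e ((s * t : F') : F' ⧸ F.subgroupOf F') := by
  simp [cosetHom, Equiv.permCongrHom, Equiv.permCongr_apply]

theorem cosetHom_zero_iff [NeZero n] (he : e ((1 : F') : F' ⧸ F.subgroupOf F') = 0) (s : F') :
    cosetHom e s 0 = 0 ↔ (s : Equiv.Perm Ω) ∈ F := by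
  rw [← he, cosetHom_apply_mk, e.apply_eq_iff_eq, mul_one, eq_comm, QuotientGroup.eq]
  simp [Subgroup.mem_subgroupOf]

/-- Since `F'` preserves the orbits of `F`, the action of an element of `F'` on the cosets of `F`
and its value on a color can be prescribed independently. -/
theorem exists_cosetHom_eq (hFF' : F ≤ F') (horb : PreservesOrbitsOf F' F) {a b : Ω}
    (hab : b ∈ MulAction.orbit F a) (i j : Fin n) :
    ∃ q : F', (q : Equiv.Perm Ω) a = b ∧ cosetHom e q i = j := by
  obtain ⟨x, rfl⟩ := e.surjective i
  obtain ⟨y, rfl⟩ := e.surjective j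
  obtain ⟨t, rfl⟩ := QuotientGroup.mk_surjective x
  obtain ⟨u, rfl⟩ := QuotientGroup.mk_surjective y
  have h1 := MulAction.orbit_eq_iff.2 (horb _ (inv_mem t.2) a)
  have h2 := MulAction.orbit_eq_iff.2 (horb _ (inv_mem u.2) b)
  have h3 := MulAction.orbit_eq_iff.2 hab
  have h4 : (u : Equiv.Perm Ω)⁻¹ b ∈ MulAction.orbit F ((t : Equiv.Perm Ω)⁻¹ a) := by
    rw [← MulAction.orbit_eq_iff, h1, h2, h3]
  obtain ⟨s, hs⟩ := h4
  refine ⟨u * ⟨s, hFF' s.2⟩ * t⁻¹, ?_, ?_⟩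
  · have hs' : (s : Equiv.Perm Ω) ((t : Equiv.Perm Ω)⁻¹ a) = (u : Equiv.Perm Ω)⁻¹ b := hs
    exact (congrArg (u : Equiv.Perm Ω) hs').trans (Equiv.apply_symm_apply _ b)
  · rw [cosetHom_apply_mk, inv_mul_cancel_right, e.apply_eq_iff_eq, QuotientGroup.eq]
    simp [Subgroup.mem_subgroupOf]

end coset

namespace LegalColoring

variable {V Ω : Type*} {T : SimpleGraph V} (c : LegalColoring T Ω)
  {F F' : Subgroup (Equiv.Perm Ω)} {n : ℕ} [NeZero n] (e : (F' ⧸ F.subgroupOf F') ≃ Fin n)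

/-- Any two finitely supported lamp configurations can be exchanged by an element of `G(F, F')`
with a prescribed behaviour at one vertex. -/
theorem exists_almostPrescribed (hT : T.IsTree) (hFF' : F ≤ F') (horb : PreservesOrbitsOf F' F)
    (he : e ((1 : F') : F' ⧸ F.subgroupOf F') = 0) (f f' : V →₀ Fin n) {v v' : V} {s : F'}
    (hs : cosetHom e s (f v) = f' v') :
    ∃ γ : c.almostPrescribed F F', γ.1 v = v' ∧ c.localPerm γ.1 v = s ∧
      ∀ w, cosetHom e ⟨c.localPerm γ.1 w, γ.2.1 w⟩ (f w) = f' (γ.1 w) := by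
  obtain ⟨g, hv, hgs, hg⟩ := c.exists_aut hT
    (R := fun w y p => ∃ h : p ∈ F', cosetHom e ⟨p, h⟩ (f w) = f' y) (v := v) (v' := v') (s := s)
    (by
      rintro w y p ⟨hp, -⟩ a
      obtain ⟨q, hq1, hq2⟩ := exists_cosetHom_eq e hFF' horb (horb p hp a)
        (f (c.nbr w a)) (f' (c.nbr y (p a)))
      exact ⟨q, ⟨q.2, hq2⟩, hq1⟩) ⟨s.2, hs⟩
  refine ⟨⟨g, fun w => (hg w).1, ?_⟩, hv, hgs, fun w => (hg w).2⟩
  -- Where both `f w` and `f' (g w)` vanish, the local permutation fixes the coset `F`, so it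
  -- belongs to `F`.
  refine ((f.hasFiniteSupport).union ((f'.hasFiniteSupport).preimage
    (f := g) g.injective.injOn)).subset fun w hw => ?_
  by_contra hcon
  simp only [Set.mem_union, Function.mem_support, Set.mem_preimage, not_or, not_not] at hcon
  obtain ⟨h1, h2⟩ := hg w
  rw [hcon.1, hcon.2, cosetHom_zero_iff e he] at h2
  exact hw h2

end LegalColoring

/-! ### Actions of the wreath product on lamp configurations -/

/-- An action on the vertices of a graph which preserves adjacency is an action on the graph. -/
def SimpleGraph.autHomOfPerm {G W : Type*} [Group G] {X : SimpleGraph W}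
    (ρ : G →* Equiv.Perm W) (h : ∀ g x y, X.Adj x y → X.Adj (ρ g x) (ρ g y)) :
    G →* (X ≃g X) where
  toFun g := ⟨ρ g, ⟨fun H => by simpa using h g⁻¹ _ _ H, h g _ _⟩⟩
  map_one' := by ext; simp
  map_mul' g k := by ext; simp

/-- The action of the automorphism group of a graph on the set of edges. -/
def SimpleGraph.edgePerm {V : Type*} (T : SimpleGraph V) : (T ≃g T) →* Equiv.Perm T.edgeSet where
  toFun g := g.mapEdgeSet
  map_one' := by
    ext ⟨a, ha⟩ : 2
    induction a with | _ x y => rfl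
  map_mul' g h := by
    ext ⟨a, ha⟩ : 2
    induction a with | _ x y => rfl

theorem SimpleGraph.coe_edgePerm {V : Type*} {T : SimpleGraph V} (g : T ≃g T) (a : T.edgeSet) :
    (T.edgePerm g a : Sym2 V) = Sym2.map g a := rfl

theorem SimpleGraph.mem_edgePerm_iff {V : Type*} {T : SimpleGraph V} {g : T ≃g T} {a : T.edgeSet}
    {v : V} : g v ∈ (T.edgePerm g a : Sym2 V) ↔ v ∈ (a : Sym2 V) := by
  rw [coe_edgePerm, Sym2.mem_map]
  exact ⟨fun ⟨u, hu, h⟩ => g.injective h ▸ hu, fun h => ⟨v, h, rfl⟩⟩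

section LampGroup

variable {V : Type*} {T : SimpleGraph V} {n : ℕ} [NeZero n]

/-- The image of a finitely supported lamp configuration under an element of `𝔖_n ≀ Aut(T)`. -/
noncomputable def lampMap (x : LampGroup n T) (f : V →₀ Fin n) : V →₀ Fin n :=
  Finsupp.ofSupportFinite (fun w => x.left w (f (x.right⁻¹ w))) (by
    have h1 : {w | ¬ x.left w ∈ MulAction.stabilizer (Equiv.Perm (Fin n)) (0 : Fin n)}.Finite :=
      x.left.2
    refine (h1.union (f.hasFiniteSupport.preimage (f := (x.right⁻¹ : T ≃g T))
      (x.right⁻¹ : T ≃g T).injective.injOn)).subset fun w hw => ?_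
    by_contra hcon
    simp only [Set.mem_union, Set.mem_ofPred_eq, Set.mem_preimage, Function.mem_support, not_or,
      not_not] at hcon
    apply hw
    beta_reduce
    rw [hcon.2]
    exact hcon.1)

theorem lampMap_apply (x : LampGroup n T) (f : V →₀ Fin n) (w : V) :
    lampMap x f w = x.left w (f (x.right⁻¹ w)) := by
  rw [lampMap, Finsupp.ofSupportFinite_coe]

theorem lampMap_mul (x y : LampGroup n T) (f : V →₀ Fin n) :
    lampMap (x * y) f = lampMap x (lampMap y f) := by
  ext w : 1
  simp only [lampMap_apply]
  rfl

theorem lampMap_one (f : V →₀ Fin n) : lampMap (1 : LampGroup n T) f = f := by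
  ext w : 1
  rw [lampMap_apply]
  rfl

/-- The action of `𝔖_n ≀ Aut(T)` on finitely supported lamp configurations: vertices are moved
by `Aut(T)` and the state at each vertex is then changed by a permutation of `{0, …, n-1}`. -/
noncomputable def lampPerm (n : ℕ) [NeZero n] (T : SimpleGraph V) :
    LampGroup n T →* Equiv.Perm (V →₀ Fin n) where
  toFun x :=
    { toFun := lampMap x
      invFun := lampMap x⁻¹
      left_inv := fun f => by rw [← lampMap_mul, inv_mul_cancel, lampMap_one]
      right_inv := fun f => by rw [← lampMap_mul, mul_inv_cancel, lampMap_one] }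
  map_one' := by ext1 f; exact lampMap_one f
  map_mul' x y := by ext1 f; exact lampMap_mul x y f

theorem lampPerm_apply (x : LampGroup n T) (f : V →₀ Fin n) (w : V) :
    lampPerm n T x f w = x.left w (f (x.right⁻¹ w)) := lampMap_apply x f w

theorem lampPerm_apply_map (x : LampGroup n T) (f : V →₀ Fin n) (w : V) :
    lampPerm n T x f (x.right w) = x.left (x.right w) (f w) := by
  rw [lampPerm_apply, RelIso.inv_apply_self]

/-- The action of `𝔖_n ≀ Aut(T)` on pairs of a lamp configuration and an element of a set on
which `Aut(T)` acts. -/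
noncomputable def lampProdPerm (n : ℕ) [NeZero n] {T : SimpleGraph V} {Y : Type*}
    (κ : (T ≃g T) →* Equiv.Perm Y) : LampGroup n T →* Equiv.Perm ((V →₀ Fin n) × Y) where
  toFun x := Equiv.prodCongr (lampPerm n T x) (κ x.right)
  map_one' := by ext <;> simp
  map_mul' x y := by ext <;> simp

/-- The action of the automorphism group of a graph on the set of vertices. -/
def SimpleGraph.vertexPerm {V : Type*} (T : SimpleGraph V) : (T ≃g T) →* Equiv.Perm V where
  toFun g := g.toEquiv
  map_one' := rfl
  map_mul' _ _ := rfl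

/-- The action of `𝔖_n ≀ Aut(T)` on the lamplighter graph. -/
noncomputable def lamplighterHom (n : ℕ) [NeZero n] (T : SimpleGraph V) :
    LampGroup n T →* (lamplighterGraph n T ≃g lamplighterGraph n T) :=
  SimpleGraph.autHomOfPerm (lampProdPerm n T.vertexPerm) (by
    rintro x ⟨f, v⟩ ⟨f', v'⟩ (⟨h, h'⟩ | ⟨h, h'⟩)
    · exact Or.inl ⟨congrArg (lampPerm n T x) h, (x.right.map_adj_iff).2 h'⟩
    · refine Or.inr ⟨congrArg x.right h, fun w => ?_⟩
      obtain ⟨w, rfl⟩ := x.right.surjective w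
      change lampPerm n T x f _ = lampPerm n T x f' _ ↔ _
      rw [lampPerm_apply_map, lampPerm_apply_map, (x.left _).apply_eq_iff_eq]
      exact (h' w).trans x.right.injective.ne_iff.symm)

/-- The graph whose vertices are the pairs of a lamp configuration and an edge of `T`, where one is
allowed to choose an end of the current edge, to change the state of the lamp there, and to
turn the edge around it. -/
def lampEdgeGraph (n : ℕ) [NeZero n] (T : SimpleGraph V) :
    SimpleGraph ((V →₀ Fin n) × T.edgeSet) where
  Adj x y := x ≠ y ∧ ∃ v, v ∈ (x.2 : Sym2 V) ∧ v ∈ (y.2 : Sym2 V) ∧ ∀ w, w ≠ v → x.1 w = y.1 w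
  symm := by
    constructor
    rintro x y ⟨hne, v, hx, hy, h⟩
    exact ⟨hne.symm, v, hy, hx, fun w hw => (h w hw).symm⟩
  loopless := by
    constructor
    exact fun x h => h.1 rfl

/-- The action of `𝔖_n ≀ Aut(T)` on `lampEdgeGraph n T`. -/
noncomputable def lampEdgeHom (n : ℕ) [NeZero n] (T : SimpleGraph V) :
    LampGroup n T →* (lampEdgeGraph n T ≃g lampEdgeGraph n T) :=
  SimpleGraph.autHomOfPerm (lampProdPerm n T.edgePerm) (by
    rintro x ⟨f, a⟩ ⟨f', a'⟩ ⟨hne, v, ha, ha', h⟩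
    refine ⟨(lampProdPerm n T.edgePerm x).injective.ne hne, x.right v,
      SimpleGraph.mem_edgePerm_iff.2 ha, SimpleGraph.mem_edgePerm_iff.2 ha', fun w hw => ?_⟩
    obtain ⟨w, rfl⟩ := x.right.surjective w
    change lampPerm n T x f _ = lampPerm n T x f' _
    rw [lampPerm_apply_map, lampPerm_apply_map]
    exact congrArg _ (h w fun hwv => hw (congrArg _ hwv)))

end LampGroup

namespace LegalColoring

variable {V Ω : Type*} {T : SimpleGraph V} (c : LegalColoring T Ω)
  {F F' : Subgroup (Equiv.Perm Ω)} {n : ℕ} [NeZero n] (e : (F' ⧸ F.subgroupOf F') ≃ Fin n)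

/-- The embedding of `G(F, F')` into `𝔖_n ≀ Aut(T)` given by the cocycle `α(σ(γ, γ⁻¹ v))`. -/
noncomputable def twist (he : e ((1 : F') : F' ⧸ F.subgroupOf F') = 0) :
    c.almostPrescribed F F' →* LampGroup n T where
  toFun γ := ⟨⟨fun v => c.cocycle e γ v, by
    refine (γ.2.2.preimage (f := (γ.1⁻¹ : T ≃g T))
      (γ.1⁻¹ : T ≃g T).injective.injOn).subset fun v hv => ?_
    refine fun hcon => hv ?_
    exact (cosetHom_zero_iff e he ⟨_, γ.2.1 _⟩).2 hcon⟩, γ.1⟩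
  map_one' := by
    refine SemidirectProduct.ext ?_ rfl
    ext v : 1
    change cosetHom e ⟨c.localPerm 1 _, _⟩ = 1
    rw [← map_one (cosetHom e)]
    congr 1
    exact Subtype.ext (c.localPerm_one _)
  map_mul' γ δ := by
    refine SemidirectProduct.ext ?_ rfl
    ext v : 1
    change cosetHom e ⟨c.localPerm (γ.1 * δ.1) _, _⟩ =
      cosetHom e ⟨c.localPerm γ.1 _, _⟩ * cosetHom e ⟨c.localPerm δ.1 _, _⟩
    rw [← map_mul]
    congr 1
    refine Subtype.ext ((c.localPerm_mul _ _ _).trans ?_)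
    change c.localPerm γ.1 (δ.1 (δ.1⁻¹ (γ.1⁻¹ v))) * _ = _
    rw [RelIso.apply_inv_self]
    rfl

variable (he : e ((1 : F') : F' ⧸ F.subgroupOf F') = 0)

theorem twist_injective : Function.Injective (c.twist e he) := fun _ _ h =>
  Subtype.ext (congrArg SemidirectProduct.right h)

theorem lampPerm_twist (γ : c.almostPrescribed F F') (f : V →₀ Fin n) (w : V) :
    lampPerm n T (c.twist e he γ) f (γ.1 w) = cosetHom e ⟨c.localPerm γ.1 w, γ.2.1 w⟩ (f w) := by
  refine (lampPerm_apply_map (c.twist e he γ) f w).trans ?_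
  change cosetHom e ⟨c.localPerm γ.1 (γ.1⁻¹ (γ.1 w)), _⟩ _ = _
  congr 3
  rw [RelIso.inv_apply_self]

theorem localPerm_mem_of_fixes_zero {γ : c.almostPrescribed F F'}
    (h : lampPerm n T (c.twist e he γ) 0 = 0) (w : V) : c.localPerm γ.1 w ∈ F := by
  have := c.lampPerm_twist e he γ 0 w
  rw [h] at this
  exact (cosetHom_zero_iff e he ⟨_, γ.2.1 w⟩).1 this.symm

theorem exists_twist_apply_eq (hT : T.IsTree) (hFF' : F ≤ F') (horb : PreservesOrbitsOf F' F)
    (f f' : V →₀ Fin n) {v v' : V} {s : F'} (hs : cosetHom e s (f v) = f' v') :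
    ∃ γ : c.almostPrescribed F F', γ.1 v = v' ∧ c.localPerm γ.1 v = s ∧
      lampPerm n T (c.twist e he γ) f = f' := by
  obtain ⟨γ, h1, h2, h3⟩ := c.exists_almostPrescribed e hT hFF' horb he f f' hs
  refine ⟨γ, h1, h2, ?_⟩
  ext w : 1
  obtain ⟨w, rfl⟩ := γ.1.surjective w
  rw [lampPerm_twist, h3]

end LegalColoring

/-! ### The topology of the wreath product as a permutation topology -/

open Filter Topology in
theorem tendsto_nhds_discrete_iff {X Y : Type*} [TopologicalSpace Y] [DiscreteTopology Y]
    {l : Filter X} {u : X → Y} {y : Y} : Tendsto u l (𝓝 y) ↔ ∀ᶠ x in l, u x = y := by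
  rw [nhds_discrete, tendsto_pure]

open Filter Topology in
/-- A group carrying the topology of pointwise convergence of an action on a discrete set is a
topological group. -/
theorem isTopologicalGroup_of_isInducing_perm {G W : Type*} [Group G] [TopologicalSpace G]
    [TopologicalSpace W] [DiscreteTopology W] (ρ : G →* Equiv.Perm W)
    (h : IsInducing (fun g => (ρ g : W → W))) : IsTopologicalGroup G := by
  have hev : ∀ (w : W) (g : G), ∀ᶠ k in 𝓝 g, ρ k w = ρ g w := fun w g => by
    have : Continuous fun k => ρ k w := (continuous_apply w).comp h.continuous
    exact tendsto_nhds_discrete_iff.1 (this.tendsto g)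
  have hcont : ∀ {X : Type _} [TopologicalSpace X] {u : X → G},
      (∀ w x, ∀ᶠ y in 𝓝 x, ρ (u y) w = ρ (u x) w) → Continuous u := by
    intro X _ u hu
    rw [h.continuous_iff, continuous_pi_iff]
    intro w
    rw [continuous_iff_continuousAt]
    intro x
    exact tendsto_nhds_discrete_iff.2 (hu w x)
  refine { continuous_mul := hcont ?_, continuous_inv := hcont ?_ }
  · rintro w ⟨g, k⟩
    have h1 := (continuous_snd.tendsto (g, k)).eventually (hev w k)
    have h2 := (continuous_fst.tendsto (g, k)).eventually (hev (ρ k w) g)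
    filter_upwards [h1, h2] with y hy1 hy2
    simp [hy1, hy2]
  · intro w g
    filter_upwards [hev (ρ g⁻¹ w) g] with k hk
    rw [map_inv, Equiv.Perm.inv_eq_iff_eq, hk]
    simp

instance (n : ℕ) : DiscreteTopology (Equiv.Perm (Fin n)) := ⟨rfl⟩

instance {V : Type*} (n : ℕ) [NeZero n] : Fact (∀ _ : V,
    IsOpen (MulAction.stabilizer (Equiv.Perm (Fin n)) (0 : Fin n) : Set (Equiv.Perm (Fin n)))) :=
  ⟨fun _ => isOpen_discrete _⟩

open Filter Topology in
/-- In a restricted product of discrete groups, pointwise convergence implies convergence provided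
that the coordinates eventually stay in fixed cosets of the subgroups. -/
theorem RestrictedProduct.tendsto_of_discrete {X ι B : Type*} [Group B] [TopologicalSpace B]
    [DiscreteTopology B] (A : Subgroup B) {l : Filter X} {u : X → Πʳ _ : ι, [B, A]}
    {u₀ : Πʳ _ : ι, [B, A]} (hA : ∀ᶠ x in l, ∀ i, (u₀ i)⁻¹ * u x i ∈ A)
    (hu : ∀ i, ∀ᶠ x in l, u x i = u₀ i) : Tendsto u l (𝓝 u₀) := by
  classical
  have : Fact (∀ _ : ι, IsOpen (A : Set B)) := ⟨fun _ => isOpen_discrete _⟩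
  let a : X → ∀ _ : ι, A := fun x i => if h : (u₀ i)⁻¹ * u x i ∈ A then ⟨_, h⟩ else 1
  have ha : Tendsto a l (𝓝 1) := by
    rw [tendsto_pi_nhds]
    intro i
    refine tendsto_nhds_discrete_iff.2 ?_
    filter_upwards [hu i] with x hx
    simp only [a, hx, inv_mul_cancel]
    rw [dif_pos (one_mem A)]
    rfl
  have hs : Continuous (RestrictedProduct.structureMap (fun _ : ι => B) (fun _ => (A : Set B))
    cofinite) := RestrictedProduct.isEmbedding_structureMap.continuous
  have h1 : Tendsto (fun x => u₀ * RestrictedProduct.structureMap (fun _ : ι => B)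
      (fun _ => (A : Set B)) cofinite (a x)) l (𝓝 (u₀ * 1)) :=
    ((hs.tendsto 1).comp ha).const_mul u₀
  rw [mul_one] at h1
  refine h1.congr' ?_
  filter_upwards [hA] with x hx
  ext i
  simp [a, hx i]

section LampGroup

variable {V : Type*} {T : SimpleGraph V} {n : ℕ} [NeZero n]

open Filter Topology

theorem eventually_aut_apply_eq (g : T ≃g T) (v : V) : ∀ᶠ k in 𝓝 g, k v = g v := by
  let _ : TopologicalSpace V := ⊥
  have : DiscreteTopology V := ⟨rfl⟩
  have h : IsInducing (fun g : T ≃g T => (g : V → V)) := ⟨rfl⟩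
  exact tendsto_nhds_discrete_iff.1 (((continuous_apply v).comp h.continuous).tendsto g)

theorem isInducing_lampGroup :
    IsInducing (fun x : LampGroup n T => (x.left, x.right)) := ⟨rfl⟩

/-- The topology of `𝔖_n ≀ Aut(T)` is the topology of pointwise convergence of its action on the
vertices of the lamplighter graph. -/
theorem isInducing_lampProdPerm [TopologicalSpace ((V →₀ Fin n) × V)]
    [DiscreteTopology ((V →₀ Fin n) × V)] :
    IsInducing (fun x : LampGroup n T =>
      (lampProdPerm n T.vertexPerm x : (V →₀ Fin n) × V → (V →₀ Fin n) × V)) := by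
  rw [isInducing_iff_nhds]
  intro x₀
  apply le_antisymm
  -- The action is continuous for the topology of the wreath product.
  · rw [← tendsto_iff_comap, tendsto_pi_nhds]
    rintro ⟨f, v⟩
    refine tendsto_nhds_discrete_iff.2 ?_
    have hleft : Continuous fun x : LampGroup n T => x.left :=
      continuous_fst.comp isInducing_lampGroup.continuous
    have hright : Continuous fun x : LampGroup n T => x.right :=
      continuous_snd.comp isInducing_lampGroup.continuous
    have h1 : ∀ v, ∀ᶠ x in 𝓝 x₀, x.right v = x₀.right v := fun v =>
      (hright.tendsto x₀).eventually (eventually_aut_apply_eq _ v)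
    have h2 : ∀ w, ∀ᶠ x in 𝓝 x₀, x.left w = x₀.left w := fun w =>
      tendsto_nhds_discrete_iff.1 (((RestrictedProduct.continuous_eval w).comp hleft).tendsto x₀)
    -- Uniformly in `w`: this is where the openness of `A^V` in the restricted product is used.
    have h3 : ∀ᶠ x in 𝓝 x₀, ∀ w, x.left w 0 = x₀.left w 0 := by
      have hopen := RestrictedProduct.isOpen_forall_mem (ι := V)
        (R := fun _ => Equiv.Perm (Fin n))
        (A := fun _ => (MulAction.stabilizer (Equiv.Perm (Fin n)) (0 : Fin n) :
          Set (Equiv.Perm (Fin n)))) (fun _ => isOpen_discrete _)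
      have := ((hleft.const_mul x₀.left⁻¹).tendsto x₀).eventually
        (hopen.mem_nhds (by
          intro w
          simp only [inv_mul_cancel]
          exact one_mem _))
      filter_upwards [this] with x hx w
      have hw : (x₀.left w)⁻¹ (x.left w 0) = 0 := hx w
      rwa [Equiv.Perm.inv_eq_iff_eq] at hw
    have h4 : ∀ᶠ x in 𝓝 x₀, ∀ w ∈ f.support, x.right w = x₀.right w :=
      (eventually_all_finset f.support).2 fun w _ => h1 w
    have h5 : ∀ᶠ x in 𝓝 x₀, ∀ w ∈ f.support, x.left (x₀.right w) = x₀.left (x₀.right w) :=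
      (eventually_all_finset f.support).2 fun w _ => h2 _
    filter_upwards [h1 v, h3, h4, h5] with x hv hx3 hx4 hx5
    refine Prod.ext ?_ hv
    ext w : 1
    obtain ⟨w, rfl⟩ := x.right.surjective w
    change lampPerm n T x f _ = lampPerm n T x₀ f _
    by_cases hw : w ∈ f.support
    · rw [lampPerm_apply_map, hx4 w hw, lampPerm_apply_map, hx5 w hw]
    · have hw' : f (x₀.right⁻¹ (x.right w)) = 0 := by
        by_contra hne
        have h6 := hx4 _ (Finsupp.mem_support_iff.2 hne)
        rw [RelIso.apply_inv_self] at h6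
        rw [x.right.injective h6] at hne
        exact hw (Finsupp.mem_support_iff.2 hne)
      rw [lampPerm_apply_map, lampPerm_apply, hw', Finsupp.notMem_support_iff.1 hw, hx3]
  -- Conversely, pointwise convergence of the action implies convergence of both components.
  · classical
    set l := comap (fun x : LampGroup n T =>
      (lampProdPerm n T.vertexPerm x : (V →₀ Fin n) × V → (V →₀ Fin n) × V))
      (𝓝 (lampProdPerm n T.vertexPerm x₀ : (V →₀ Fin n) × V → (V →₀ Fin n) × V)) with hl
    have hev : ∀ y, ∀ᶠ x in l, lampProdPerm n T.vertexPerm x y =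
        lampProdPerm n T.vertexPerm x₀ y := by
      intro y
      have h1 := (continuous_apply y).continuousAt.tendsto.comp (tendsto_comap (f := fun
        x : LampGroup n T => (lampProdPerm n T.vertexPerm x : (V →₀ Fin n) × V → (V →₀ Fin n) × V))
        (x := 𝓝 (lampProdPerm n T.vertexPerm x₀ : (V →₀ Fin n) × V → (V →₀ Fin n) × V)))
      exact tendsto_nhds_discrete_iff.1 h1
    have hv : ∀ v, ∀ᶠ x in l, x.right v = x₀.right v := fun v =>
      (hev (0, v)).mono fun x hx => congrArg Prod.snd hx
    have hright : Tendsto (fun x : LampGroup n T => x.right) l (𝓝 x₀.right) := by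
      let _ : TopologicalSpace V := ⊥
      have : DiscreteTopology V := ⟨rfl⟩
      have h : IsInducing (fun g : T ≃g T => (g : V → V)) := ⟨rfl⟩
      rw [h.tendsto_nhds_iff, tendsto_pi_nhds]
      intro v
      exact tendsto_nhds_discrete_iff.2 (hv v)
    rcases isEmpty_or_nonempty V with hV | ⟨⟨v₀⟩⟩
    · have : ∀ x, x = x₀ := fun x =>
        SemidirectProduct.ext (RestrictedProduct.ext _ _ fun w => hV.elim w)
          (RelIso.ext fun w => hV.elim w)
      intro s hs
      have := mem_of_mem_nhds hs
      exact Filter.mem_of_superset univ_mem fun x _ => by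
        rw [‹∀ x, x = x₀› x]; exact this
    have hf : ∀ f : V →₀ Fin n, ∀ᶠ x in l, lampPerm n T x f = lampPerm n T x₀ f := fun f =>
      (hev (f, v₀)).mono fun x hx => congrArg Prod.fst hx
    have hleft : Tendsto (fun x : LampGroup n T => x.left) l (𝓝 x₀.left) := by
      apply RestrictedProduct.tendsto_of_discrete
      -- Following the zero configuration controls the coset of `x.left w` for all `w` at once.
      · filter_upwards [hf 0] with x hx w
        have := DFunLike.congr_fun hx w
        rw [lampPerm_apply, lampPerm_apply] at this
        change (x₀.left w)⁻¹ (x.left w 0) = 0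
        rw [Equiv.Perm.inv_eq_iff_eq]
        exact this
      · intro w
        obtain ⟨w, rfl⟩ := x₀.right.surjective w
        -- The configurations supported at one vertex determine the permutation at this vertex.
        have h1 : ∀ᶠ x in l, ∀ i : Fin n, lampPerm n T x (Finsupp.single w i) =
            lampPerm n T x₀ (Finsupp.single w i) := eventually_all.2 fun i => hf _
        filter_upwards [h1, hv w] with x hx hw
        ext1 i
        have h2 := DFunLike.congr_fun (hx i) (x₀.right w)
        rw [lampPerm_apply_map, ← hw, lampPerm_apply_map, Finsupp.single_eq_same] at h2
        rw [← hw, h2]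
    rw [isInducing_lampGroup.nhds_eq_comap, ← tendsto_iff_comap, nhds_prod_eq]
    exact hleft.prodMk hright

theorem lampProdPerm_injective [Nonempty V] :
    Function.Injective (lampProdPerm n T.vertexPerm) := by
  classical
  intro x y h
  have h1 : ∀ z, lampProdPerm n T.vertexPerm x z = lampProdPerm n T.vertexPerm y z := fun z => by
    rw [h]
  obtain ⟨v₀⟩ := ‹Nonempty V›
  have hr : x.right = y.right := RelIso.ext fun v => congrArg Prod.snd (h1 (0, v))
  refine SemidirectProduct.ext ?_ hr
  ext w : 1
  obtain ⟨w, rfl⟩ := x.right.surjective w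
  ext1 i
  have h2 := DFunLike.congr_fun (congrArg Prod.fst (h1 (Finsupp.single w i, v₀))) (x.right w)
  change lampPerm n T x _ _ = lampPerm n T y _ _ at h2
  rw [lampPerm_apply_map, hr, lampPerm_apply_map, Finsupp.single_eq_same] at h2
  rw [hr, h2]

theorem isTopologicalGroup_lampGroup : IsTopologicalGroup (LampGroup n T) := by
  let _ : TopologicalSpace ((V →₀ Fin n) × V) := ⊥
  have : DiscreteTopology ((V →₀ Fin n) × V) := ⟨rfl⟩
  exact isTopologicalGroup_of_isInducing_perm _ isInducing_lampProdPerm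

theorem t2Space_lampGroup [Nonempty V] : T2Space (LampGroup n T) := by
  let _ : TopologicalSpace ((V →₀ Fin n) × V) := ⊥
  have : DiscreteTopology ((V →₀ Fin n) × V) := ⟨rfl⟩
  have h : IsEmbedding (fun x : LampGroup n T =>
      (lampProdPerm n T.vertexPerm x : (V →₀ Fin n) × V → (V →₀ Fin n) × V)) :=
    ⟨isInducing_lampProdPerm, DFunLike.coe_injective.comp lampProdPerm_injective⟩
  exact h.t2Space

/-- The stabilizer of a vertex of the lamplighter graph in `𝔖_n ≀ Aut(T)`. -/
noncomputable def lampStabilizer (n : ℕ) [NeZero n] (T : SimpleGraph V) (y : (V →₀ Fin n) × V) :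
    Subgroup (LampGroup n T) :=
  (MulAction.stabilizer (Equiv.Perm ((V →₀ Fin n) × V)) y).comap (lampProdPerm n T.vertexPerm)

theorem mem_lampStabilizer {y : (V →₀ Fin n) × V} {x : LampGroup n T} :
    x ∈ lampStabilizer n T y ↔ lampProdPerm n T.vertexPerm x y = y := Iff.rfl

theorem isOpen_lampStabilizer (y : (V →₀ Fin n) × V) :
    IsOpen (lampStabilizer n T y : Set (LampGroup n T)) := by
  let _ : TopologicalSpace ((V →₀ Fin n) × V) := ⊥
  have : DiscreteTopology ((V →₀ Fin n) × V) := ⟨rfl⟩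
  have h := (continuous_apply y).comp (isInducing_lampProdPerm (n := n) (T := T)).continuous
  exact (isOpen_discrete {y}).preimage h

end LampGroup

/-! ### Compactness of stabilizers -/

section Compact

variable {V Ω : Type*} {T : SimpleGraph V}

theorem LegalColoring.finite_orbit_stabilizer [Finite Ω] (c : LegalColoring T Ω)
    (hT : T.Connected) (v₀ w : V) :
    {u | ∃ g : T ≃g T, g v₀ = v₀ ∧ g w = u}.Finite := by
  refine c.nbr_induction hT (P := fun w => {u | ∃ g : T ≃g T, g v₀ = v₀ ∧ g w = u}.Finite)
    (v := v₀) ?_ ?_ w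
  · refine (Set.finite_singleton v₀).subset ?_
    rintro u ⟨g, hg, rfl⟩
    exact hg
  · intro w a hw
    refine (hw.biUnion (t := fun u => Set.range (c.nbr u)) fun u _ => Set.finite_range _).subset ?_
    rintro u ⟨g, hg, rfl⟩
    rw [c.map_nbr]
    exact Set.mem_biUnion ⟨g, hg, rfl⟩ ⟨_, rfl⟩

open Filter Topology in
/-- The stabilizer of a vertex in the automorphism group of a connected locally finite graph is
compact. -/
theorem LegalColoring.isCompact_stabilizer [Finite Ω] (c : LegalColoring T Ω)
    (hT : T.Connected) (v₀ : V) :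
    IsCompact {g : T ≃g T | g v₀ = v₀} := by
  let _ : TopologicalSpace V := ⊥
  have : DiscreteTopology V := ⟨rfl⟩
  have hind : IsInducing (fun g : T ≃g T => (g : V → V)) := ⟨rfl⟩
  rw [hind.isCompact_iff]
  have hK : IsCompact (Set.univ.pi fun w => {u | ∃ g : T ≃g T, g v₀ = v₀ ∧ g w = u}) :=
    isCompact_univ_pi fun w => (c.finite_orbit_stabilizer hT v₀ w).isCompact
  refine hK.of_isClosed_subset ?_ ?_
  · refine closure_subset_iff_isClosed.1 fun f hf => ?_
    -- A pointwise limit of automorphisms agrees with one of them on any given finite set.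
    have key : ∀ S : Set V, S.Finite → ∃ g : T ≃g T, g v₀ = v₀ ∧ ∀ x ∈ S, g x = f x := by
      intro S hS
      have h1 : ∀ᶠ f' in 𝓝 f, ∀ x ∈ S, f' x = f x := by
        rw [eventually_all_finite hS]
        exact fun x _ => tendsto_nhds_discrete_iff.1 ((continuous_apply x).tendsto f)
      obtain ⟨_, ⟨g, hg, rfl⟩, h⟩ := ((mem_closure_iff_frequently.1 hf).and_eventually h1).exists
      exact ⟨g, hg, h⟩
    have hinj : Function.Injective f := by
      intro x y hxy
      obtain ⟨g, -, h⟩ := key {x, y} (Set.toFinite _)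
      apply g.injective
      rw [h x (by simp), h y (by simp), hxy]
    have hsurj : Function.Surjective f := by
      intro u
      -- The preimage of `u` under any automorphism fixing `v₀` lies in the finite orbit of `u`.
      obtain ⟨g, hg, h⟩ := key _ (c.finite_orbit_stabilizer hT v₀ u)
      refine ⟨g⁻¹ u, ?_⟩
      rw [← h (g⁻¹ u) ⟨g⁻¹, ?_, rfl⟩, RelIso.apply_inv_self]
      conv_lhs => rw [← hg]
      rw [RelIso.inv_apply_self]
    refine ⟨⟨Equiv.ofBijective f ⟨hinj, hsurj⟩, fun {x y} => ?_⟩, ?_, rfl⟩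
    · obtain ⟨g, -, h⟩ := key {x, y} (Set.toFinite _)
      change T.Adj (f x) (f y) ↔ _
      rw [← h x (by simp), ← h y (by simp)]
      exact g.map_adj_iff
    · obtain ⟨g, hg, h⟩ := key {v₀} (Set.toFinite _)
      exact (h v₀ rfl).symm.trans hg
  · rintro _ ⟨g, hg, rfl⟩ w -
    exact ⟨g, hg, rfl⟩

theorem LegalColoring.isCompact_lampStabilizer [Finite Ω] (c : LegalColoring T Ω)
    (hT : T.Connected) (n : ℕ) [NeZero n]
    (v₀ : V) : IsCompact (lampStabilizer n T (0, v₀) : Set (LampGroup n T)) := by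
  let A := MulAction.stabilizer (Equiv.Perm (Fin n)) (0 : Fin n)
  let ι : (∀ _ : V, A) × (T ≃g T) → LampGroup n T := fun p =>
    ⟨RestrictedProduct.structureMap (fun _ => Equiv.Perm (Fin n))
      (fun _ => (A : Set (Equiv.Perm (Fin n)))) Filter.cofinite p.1, p.2⟩
  have hι : Continuous ι := by
    refine isInducing_lampGroup.continuous_iff.2 ?_
    exact (RestrictedProduct.isEmbedding_structureMap.continuous.comp continuous_fst).prodMk
      continuous_snd
  have h := ((isCompact_univ (X := ∀ _ : V, A)).prod (c.isCompact_stabilizer hT v₀)).image hι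
  convert h
  ext x
  constructor
  · intro hx
    have hx' : lampProdPerm n T.vertexPerm x (0, v₀) = (0, v₀) := hx
    have h1 : lampPerm n T x 0 = 0 := congrArg Prod.fst hx'
    have h2 : ∀ w, x.left w ∈ A := fun w => by
      have := DFunLike.congr_fun h1 w
      rwa [lampPerm_apply] at this
    exact ⟨(fun w => ⟨x.left w, h2 w⟩, x.right), ⟨trivial, congrArg Prod.snd hx'⟩, rfl⟩
  · rintro ⟨⟨a, g⟩, ⟨-, hg⟩, rfl⟩
    refine Prod.ext ?_ hg
    ext w : 1
    exact (lampPerm_apply _ _ _).trans (a w).2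

end Compact

/-! ### A criterion for cocompact lattices -/

section Lattice

variable {G : Type*} [Group G] [TopologicalSpace G] [IsTopologicalGroup G]

open MeasureTheory Measure

/-- If `O` is an open subgroup of `G` and `Γ` is a countable subgroup with `G = O Γ`, then every
point of `G` belongs to the same number of the sets `g O γ⁻¹`, `γ ∈ Γ`, namely the cardinality of `O ∩ Γ`;
this is the integrated form of this fact. -/
theorem tsum_measure_inter_coset [MeasurableSpace G] [BorelSpace G] (μ : Measure G)
    {O Γ : Subgroup G} (hO : IsOpen (O : Set G)) [Countable Γ]
    (hmul : ∀ g, ∃ o ∈ O, ∃ γ ∈ Γ, o * γ = g) (A : Set G) (g : G) :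
    ∑' γ : Γ, μ (A ∩ {x | g⁻¹ * (x * γ) ∈ O}) =
      (∑' γ : Γ, (O : Set G).indicator (fun _ => (1 : ENNReal)) γ) * μ A := by
  have hS : ∀ γ : Γ, MeasurableSet {x : G | g⁻¹ * (x * γ) ∈ O} := fun γ =>
    (hO.preimage (by fun_prop : Continuous fun x : G => g⁻¹ * (x * γ))).measurableSet
  have h1 : ∀ γ : Γ, μ (A ∩ {x | g⁻¹ * (x * γ) ∈ O}) =
      ∫⁻ x in A, {x : G | g⁻¹ * (x * γ) ∈ O}.indicator (fun _ => 1) x ∂μ := by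
    intro γ
    rw [lintegral_indicator (hS γ), setLIntegral_const, one_mul, restrict_apply (hS γ),
      Set.inter_comm]
  simp_rw [h1]
  rw [← lintegral_tsum fun γ => (measurable_const.indicator (hS γ)).aemeasurable,
    ← setLIntegral_const]
  congr 1
  ext x
  obtain ⟨o, ho, γ₀, hγ₀, hx⟩ := hmul (g⁻¹ * x)
  rw [← (Equiv.mulLeft (⟨γ₀, hγ₀⟩ : Γ)).tsum_eq
    (fun γ : Γ => (O : Set G).indicator (fun _ => (1 : ENNReal)) (γ : G))]
  congr 1
  ext γ
  have h2 : g⁻¹ * (x * γ) = o * (γ₀ * γ) := by rw [← mul_assoc, ← hx, mul_assoc]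
  have h3 : g⁻¹ * (x * γ) ∈ O ↔ γ₀ * γ ∈ O := by rw [h2]; exact O.mul_mem_cancel_left ho
  classical
  rw [Set.indicator_apply, Set.indicator_apply]
  exact if_congr h3 rfl rfl

/-- The key computation for the unimodularity of `G` and for the invariance of the measure on
`G ⧸ Γ`: the parts of a right `Γ`-invariant set in two left cosets of `O` are compared by cutting
them along the right translates of `O` by `Γ`. -/
theorem measure_inter_coset [LocallyCompactSpace G] [MeasurableSpace G] [BorelSpace G]
    (μ : Measure G) [IsHaarMeasure μ] [Regular μ] {O Γ : Subgroup G} (hO : IsOpen (O : Set G))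
    (hOc : IsCompact (O : Set G)) [Countable Γ] (hfin : {γ : Γ | (γ : G) ∈ O}.Finite)
    (hmul : ∀ g, ∃ o ∈ O, ∃ γ ∈ Γ, o * γ = g) {E : Set G} (hE : MeasurableSet E)
    (hEΓ : ∀ x, ∀ γ ∈ Γ, x * γ ∈ E ↔ x ∈ E) (g : G) :
    μ (E ∩ {x | g⁻¹ * x ∈ O}) = modularCharacter g⁻¹ * μ (E ∩ O) := by
  have hOpos : μ O ≠ 0 := (hO.measure_pos μ ⟨1, one_mem O⟩).ne'
  have hOfin : μ O ≠ ⊤ := hOc.measure_lt_top.ne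
  have hmap : ∀ (x : G) {B : Set G}, MeasurableSet B →
      μ {y | y * x ∈ B} = modularCharacter x * μ B := by
    intro x B hB
    have : (map (· * x) μ).Regular := Regular.map (Homeomorph.mulRight x)
    have h1 : map (· * x) μ = modularCharacterFun x • μ := by
      rw [modularCharacterFun_eq_haarScalarFactor μ]
      exact isMulLeftInvariant_eq_smul_of_regular _ μ
    have h2 := congrArg (fun ν : Measure G => ν B) h1
    beta_reduce at h2
    rw [map_apply (measurable_mul_const x) hB] at h2
    exact h2
  -- The modular character is trivial on `O`, since `O o = O` for `o ∈ O`.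
  have hone : ∀ o ∈ O, modularCharacter (G := G) o = 1 := by
    intro o ho
    have h1 := hmap o hO.measurableSet
    have h2 : {y | y * o ∈ (O : Set G)} = O := by
      ext y
      exact O.mul_mem_cancel_right ho
    rw [h2] at h1
    have h3 : ((modularCharacter o : NNReal) : ENNReal) * μ O = 1 * μ O := by
      rw [one_mul]
      exact h1.symm
    exact_mod_cast (ENNReal.mul_left_inj hOpos hOfin).1 h3
  -- `M` is the cardinality of `O ∩ Γ`.
  set M := ∑' γ : Γ, (O : Set G).indicator (fun _ => (1 : ENNReal)) γ with hM
  have hM0 : M ≠ 0 := by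
    intro h
    simpa [one_mem] using ENNReal.tsum_eq_zero.1 h 1
  have hMtop : M ≠ ⊤ := by
    rw [hM, tsum_eq_sum (s := hfin.toFinset) (by
      intro γ hγ
      have : (γ : G) ∉ O := fun h => hγ (hfin.mem_toFinset.2 h)
      exact Set.indicator_of_notMem this _)]
    refine (ENNReal.sum_lt_top.2 fun γ _ => ?_).ne
    by_cases h : (γ : G) ∈ (O : Set G)
    · simp [Set.indicator_of_mem h]
    · simp [Set.indicator_of_notMem h]
  have hgO : MeasurableSet {x : G | g⁻¹ * x ∈ O} :=
    (hO.preimage (continuous_const_mul g⁻¹)).measurableSet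
  -- Cut `E ∩ g O` along the sets `O γ⁻¹` and `E ∩ O` along the sets `g O γ`, then match the pieces
  -- by right translations.
  have hL := tsum_measure_inter_coset μ hO hmul (E ∩ {x | g⁻¹ * x ∈ O}) 1
  have hR := tsum_measure_inter_coset μ hO hmul (E ∩ O) g
  rw [← (Equiv.inv Γ).tsum_eq (fun γ : Γ => μ (E ∩ O ∩ {x | g⁻¹ * (x * γ) ∈ O}))] at hR
  have hterm : ∀ γ : Γ, μ (E ∩ {x | g⁻¹ * x ∈ O} ∩ {x | 1⁻¹ * (x * γ) ∈ O}) =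
      modularCharacter g⁻¹ * μ (E ∩ O ∩ {x | g⁻¹ * (x * (Equiv.inv Γ γ : Γ)) ∈ O}) := by
    intro γ
    have hmeas : MeasurableSet (E ∩ O ∩ {x | g⁻¹ * (x * (Equiv.inv Γ γ : Γ)) ∈ O}) :=
      (hE.inter hO.measurableSet).inter (hO.preimage (by fun_prop)).measurableSet
    have hset : E ∩ {x | g⁻¹ * x ∈ O} ∩ {x | 1⁻¹ * (x * γ) ∈ O} =
        {y : G | y * γ ∈ E ∩ O ∩ {x | g⁻¹ * (x * (Equiv.inv Γ γ : Γ)) ∈ O}} := by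
      ext y
      simp only [Set.mem_inter_iff, Set.mem_ofPred_eq, inv_one, one_mul, Equiv.inv_apply,
        Subgroup.coe_inv, mul_inv_cancel_right, SetLike.mem_coe, hEΓ y γ γ.2]
      tauto
    rw [hset, hmap _ hmeas]
    rcases Set.eq_empty_or_nonempty (E ∩ O ∩ {x | g⁻¹ * (x * (Equiv.inv Γ γ : Γ)) ∈ O}) with
      h | ⟨y, ⟨-, hy⟩, hy'⟩
    · rw [h, measure_empty, mul_zero, mul_zero]
    -- If the piece is non-empty then `γ ∈ O g⁻¹ O`, so that translating by `γ` scales the measure by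
    -- the value of the modular character at `g⁻¹`.
    · congr 2
      have h1 := hone _ hy'
      simp only [Equiv.inv_apply, Subgroup.coe_inv, map_mul, hone y hy, one_mul] at h1
      have h2 : modularCharacter (γ : G)⁻¹ * modularCharacter (γ : G) = 1 := by
        rw [← map_mul, inv_mul_cancel, map_one]
      calc modularCharacter (γ : G)
          = (modularCharacter g⁻¹ * modularCharacter (γ : G)⁻¹) * modularCharacter (γ : G) := by
            rw [h1, one_mul]
        _ = modularCharacter g⁻¹ := by rw [mul_assoc, h2, mul_one]
  simp_rw [hterm] at hL
  rw [ENNReal.tsum_mul_left, hR, mul_left_comm] at hL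
  exact ((ENNReal.mul_right_inj hM0 hMtop).1 hL).symm

/-- A countable subgroup which, for some compact open subgroup `O`, meets `O` in a finite set and
satisfies `G = O Γ`, is a cocompact lattice. -/
theorem isCocompactLattice_of_isCompact_isOpen [T2Space G] {O Γ : Subgroup G}
    (hO : IsOpen (O : Set G)) (hOc : IsCompact (O : Set G)) [Countable Γ]
    (hfin : {γ : Γ | (γ : G) ∈ O}.Finite) (hmul : ∀ g, ∃ o ∈ O, ∃ γ ∈ Γ, o * γ = g) :
    IsCocompactLattice Γ := by
  have hquot : (QuotientGroup.mk : G → G ⧸ Γ) '' O = Set.univ := by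
    refine Set.eq_univ_of_forall fun x => ?_
    obtain ⟨g, rfl⟩ := QuotientGroup.mk_surjective x
    obtain ⟨o, ho, γ, hγ, rfl⟩ := hmul g
    exact ⟨o, ho, QuotientGroup.eq.2 (by simpa using hγ)⟩
  refine ⟨⟨?_, ?_⟩, ⟨hquot ▸ hOc.image QuotientGroup.continuous_mk⟩⟩
  -- The open neighbourhood `O ∩ Γ` of `1` in `Γ` is finite, and `Γ` is Hausdorff.
  · refine discreteTopology_of_isOpen_singleton_one ?_
    have h1 : IsOpen {γ : Γ | (γ : G) ∈ O} := hO.preimage continuous_subtype_val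
    have h2 : IsClosed ({γ : Γ | (γ : G) ∈ O} \ {1}) := (hfin.subset Set.sdiff_subset).isClosed
    have h3 : ({1} : Set Γ) = {γ : Γ | (γ : G) ∈ O} \ ({γ : Γ | (γ : G) ∈ O} \ {1}) := by
      ext γ
      simp only [Set.mem_singleton_iff, Set.mem_sdiff, Set.mem_ofPred_eq, not_and, not_not]
      refine ⟨?_, fun h => h.2 h.1⟩
      rintro rfl
      exact ⟨one_mem O, fun _ => rfl⟩
    rw [h3]
    exact h1.sdiff h2
  · borelize G
    let _ : MeasurableSpace (G ⧸ Γ) := borel (G ⧸ Γ)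
    have : BorelSpace (G ⧸ Γ) := ⟨rfl⟩
    have : LocallyCompactSpace G :=
      hOc.locallyCompactSpace_of_mem_nhds_of_group (hO.mem_nhds (one_mem O))
    let μ : Measure G := haar
    have hOpos : μ O ≠ 0 := (hO.measure_pos μ ⟨1, one_mem O⟩).ne'
    have hOfin : μ O ≠ ⊤ := hOc.measure_lt_top.ne
    have hmk : Measurable (QuotientGroup.mk : G → G ⧸ Γ) :=
      QuotientGroup.continuous_mk.measurable
    -- Unimodularity: compare the measures of `O` and of its left translates.
    have huni : ∀ g : G, ((modularCharacter g⁻¹ : NNReal) : ENNReal) = 1 := by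
      intro g
      have h := measure_inter_coset μ hO hOc hfin hmul MeasurableSet.univ (by simp) g
      rw [Set.univ_inter, Set.univ_inter] at h
      have h1 : μ {x | g⁻¹ * x ∈ O} = μ O := measure_preimage_mul μ g⁻¹ (O : Set G)
      rw [h1] at h
      have h2 : ((modularCharacter g⁻¹ : NNReal) : ENNReal) * μ O = 1 * μ O := by
        rw [one_mul]
        exact h.symm
      exact (ENNReal.mul_left_inj hOpos hOfin).1 h2
    refine ⟨(μ.restrict O).map QuotientGroup.mk, ?_, ?_, ?_⟩
    · rw [map_apply hmk MeasurableSet.univ]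
      simpa using hOpos
    · rw [map_apply hmk MeasurableSet.univ]
      simpa using hOfin
    · intro g E hE
      have hg : Measurable fun x : G ⧸ Γ => g • x := (continuous_const_smul g).measurable
      rw [map_apply hmk (hg hE), map_apply hmk hE, restrict_apply (hmk (hg hE)),
        restrict_apply (hmk hE)]
      have h1 := measure_inter_coset μ hO hOc hfin hmul (hmk hE) (by
        intro x γ hγ
        have : ((x * γ : G) : G ⧸ Γ) = (x : G ⧸ Γ) := QuotientGroup.mk_mul_of_mem x hγ
        rw [Set.mem_preimage, Set.mem_preimage, this]) g
      rw [huni, one_mul] at h1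
      rw [← h1, ← measure_preimage_mul μ g (_ ∩ {x | g⁻¹ * x ∈ O})]
      congr 1
      ext x
      simp only [Set.mem_inter_iff, Set.mem_preimage, Set.mem_ofPred_eq, inv_mul_cancel_left,
        SetLike.mem_coe]
      rfl

end Lattice

/-! ### The lattice and its action on the lamplighter graph -/

namespace LegalColoring

section Tree

variable {V Ω : Type*} {T : SimpleGraph V}

theorem countable_vertices [Countable Ω] (c : LegalColoring T Ω) (hT : T.Connected) :
    Countable V := by
  obtain ⟨v₀⟩ := hT.nonempty
  have : Function.Surjective fun l : List Ω => l.foldl c.nbr v₀ :=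
    c.nbr_induction hT (v := v₀) ⟨[], rfl⟩ fun w a ⟨l, hl⟩ => ⟨l ++ [a], by simp [← hl]⟩
  exact this.countable

/-- A finite tree would have a leaf. -/
theorem infinite_vertices [Fintype Ω] (c : LegalColoring T Ω) (hT : T.IsTree)
    (hΩ : 2 ≤ Fintype.card Ω) : Infinite V := by
  classical
  by_contra hcon
  have : Finite V := not_infinite_iff_finite.1 hcon
  have := Fintype.ofFinite V
  obtain ⟨v₀⟩ := hT.connected.nonempty
  have hpos : 0 < Fintype.card Ω := by lia
  obtain ⟨a⟩ : Nonempty Ω := Fintype.card_pos_iff.1 hpos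
  have : Nontrivial V := ⟨v₀, c.nbr v₀ a, (c.adj_nbr v₀ a).ne⟩
  obtain ⟨v, hv⟩ := hT.exists_vert_degree_one_of_nontrivial
  have h : T.degree v = Fintype.card Ω := by
    rw [← SimpleGraph.card_neighborSet_eq_degree]
    exact Fintype.card_congr (c.starEquiv v)
  lia

end Tree

variable {V Ω : Type*} {T : SimpleGraph V} (c : LegalColoring T Ω)
  {F F' : Subgroup (Equiv.Perm Ω)} {n : ℕ} [NeZero n] (e : (F' ⧸ F.subgroupOf F') ≃ Fin n)
  (he : e ((1 : F') : F' ⧸ F.subgroupOf F') = 0)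

/-- `G(F, F')` acts transitively on the vertices of the lamplighter graph. -/
theorem exists_twist_vertex_eq [Nonempty Ω] (hT : T.IsTree) (hFF' : F ≤ F')
    (horb : PreservesOrbitsOf F' F) (f f' : V →₀ Fin n) (v v' : V) :
    ∃ γ : c.almostPrescribed F F', γ.1 v = v' ∧ lampPerm n T (c.twist e he γ) f = f' := by
  obtain ⟨a⟩ := ‹Nonempty Ω›
  obtain ⟨s, -, hs⟩ := exists_cosetHom_eq e hFF' horb (MulAction.mem_orbit_self a) (f v) (f' v')
  obtain ⟨γ, h1, -, h2⟩ := c.exists_twist_apply_eq e he hT hFF' horb f f' hs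
  exact ⟨γ, h1, h2⟩

/-- An element of `G(F, F')` which fixes the zero configuration, a vertex, and an edge around it, is
trivial. -/
theorem eq_one_of_twist_fixes (hT : T.Connected) (hF : IsSemiregularPermGroup F)
    {γ : c.almostPrescribed F F'} (h0 : lampPerm n T (c.twist e he γ) 0 = 0) {v : V} {a : Ω}
    (hv : γ.1 v = v) (ha : c.localPerm γ.1 v a = a) : γ = 1 :=
  Subtype.ext (c.eq_one_of_fixes hT hF (c.localPerm_mem_of_fixes_zero e he h0) hv ha)

/-- Stabilizers of vertices of the lamplighter graph are finite: their elements are determined by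
one local permutation. -/
theorem finite_twist_stabilizer [Finite Ω] [Nonempty Ω] (hT : T.Connected)
    (hF : IsSemiregularPermGroup F) (v : V) :
    {γ : c.almostPrescribed F F' | γ.1 v = v ∧ lampPerm n T (c.twist e he γ) 0 = 0}.Finite := by
  obtain ⟨a⟩ := ‹Nonempty Ω›
  refine Set.Finite.of_injOn (f := fun γ => c.localPerm γ.1 v) (t := Set.univ)
    (fun _ _ => trivial) ?_ Set.finite_univ
  rintro γ ⟨hγv, hγ0⟩ δ ⟨hδv, hδ0⟩ h
  have h0 : lampPerm n T (c.twist e he (γ⁻¹ * δ)) 0 = 0 := by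
    rw [map_mul, map_mul, Equiv.Perm.mul_apply, hδ0, map_inv, map_inv, Equiv.Perm.inv_eq_iff_eq,
      hγ0]
  have hv : (γ⁻¹ * δ).1 v = v := by
    change γ.1⁻¹ (δ.1 v) = v
    rw [hδv]
    conv_lhs => rw [← hγv]
    rw [RelIso.inv_apply_self]
  refine inv_mul_eq_one.1 (c.eq_one_of_twist_fixes e he hT hF h0 hv (a := a) ?_)
  have h1 : c.localPerm γ.1 v * c.localPerm (γ⁻¹ * δ).1 v = c.localPerm δ.1 v := by
    have h2 := c.localPerm_mul γ.1 (γ⁻¹ * δ).1 v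
    rw [hv] at h2
    rw [← h2, ← Subgroup.coe_mul, mul_inv_cancel_left]
  have h2 : c.localPerm (γ⁻¹ * δ).1 v = 1 := by
    rw [← mul_eq_left (a := c.localPerm γ.1 v), h1]
    exact h.symm
  rw [h2]
  rfl

theorem isProperGraphAction_twist [Finite Ω] [Nonempty Ω] (hT : T.IsTree) (hFF' : F ≤ F')
    (hF : IsSemiregularPermGroup F) (horb : PreservesOrbitsOf F' F) :
    IsProperGraphAction ((lamplighterHom n T).comp (c.twist e he)) := by
  obtain ⟨v₀⟩ := hT.connected.nonempty
  have hex : ∀ x : (V →₀ Fin n) × V,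
      ∃ γ, (lamplighterHom n T).comp (c.twist e he) γ (0, v₀) = x := by
    rintro ⟨f, v⟩
    obtain ⟨γ, h1, h2⟩ := c.exists_twist_vertex_eq e he hT hFF' horb 0 f v₀ v
    exact ⟨γ, Prod.ext h2 h1⟩
  intro x y
  obtain ⟨γ, rfl⟩ := hex x
  obtain ⟨δ, rfl⟩ := hex y
  refine ((c.finite_twist_stabilizer e he hT.connected hF v₀).preimage
    (f := fun ε => δ⁻¹ * ε * γ) (fun _ _ _ _ h => by simpa using h)).subset fun ε hε => ?_
  have h : (lamplighterHom n T).comp (c.twist e he) (δ⁻¹ * ε * γ) (0, v₀) = (0, v₀) := by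
    rw [map_mul, map_mul, RelIso.mul_apply, RelIso.mul_apply, hε, map_inv, RelIso.inv_apply_self]
  exact ⟨congrArg Prod.snd h, congrArg Prod.fst h⟩

theorem isCocompactGraphAction_twist [Finite Ω] [Nonempty Ω] (hT : T.IsTree) (hFF' : F ≤ F')
    (horb : PreservesOrbitsOf F' F) :
    IsCocompactGraphAction ((lamplighterHom n T).comp (c.twist e he)) := by
  classical
  obtain ⟨v₀⟩ := hT.connected.nonempty
  have hex : ∀ x : (V →₀ Fin n) × V,
      ∃ γ, (lamplighterHom n T).comp (c.twist e he) γ x = (0, v₀) := by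
    rintro ⟨f, v⟩
    obtain ⟨γ, h1, h2⟩ := c.exists_twist_vertex_eq e he hT hFF' horb f 0 v v₀
    exact ⟨γ, Prod.ext h2 h1⟩
  refine ⟨⟨{(0, v₀)}, Set.finite_singleton _, hex⟩,
    (fun y => s((0, v₀), y)) '' {y | (lamplighterGraph n T).Adj (0, v₀) y},
    Set.Finite.image _ ?_, ?_⟩
  · refine ((Set.finite_range fun a => ((0 : V →₀ Fin n), c.nbr v₀ a)).union
      (Set.finite_range fun i : Fin n => (Finsupp.single v₀ i, v₀))).subset ?_
    rintro ⟨f, v⟩ (⟨h, h'⟩ | ⟨h, h'⟩)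
    · obtain ⟨a, ha⟩ := c.exists_nbr_eq h'
      exact Or.inl ⟨a, Prod.ext h ha⟩
    · refine Or.inr ⟨f v₀, Prod.ext ?_ h⟩
      ext w : 1
      by_cases hw : w = v₀
      · rw [hw]
        exact Finsupp.single_eq_same
      · exact (Finsupp.single_eq_of_ne hw).trans ((h' w).2 hw)
  · intro a ha
    induction a with
    | _ x y =>
      obtain ⟨γ, hγ⟩ := hex x
      refine ⟨γ, _, ?_, by rw [Sym2.map_mk, hγ]⟩
      have h := ((lamplighterHom n T).comp (c.twist e he) γ).map_adj_iff.2 ha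
      rwa [hγ] at h

theorem isCocompactLattice_twist [Finite Ω] [Nonempty Ω] (hT : T.IsTree) (hFF' : F ≤ F')
    (hF : IsSemiregularPermGroup F) (horb : PreservesOrbitsOf F' F) :
    IsCocompactLattice (c.twist e he).range := by
  have hprop := c.isProperGraphAction_twist e he hT hFF' hF horb
  obtain ⟨v₀⟩ := hT.connected.nonempty
  have : Nonempty V := ⟨v₀⟩
  have : Countable V := c.countable_vertices hT.connected
  have : IsTopologicalGroup (LampGroup n T) := isTopologicalGroup_lampGroup
  have : T2Space (LampGroup n T) := t2Space_lampGroup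
  have : Countable (c.almostPrescribed F F') := by
    rw [← Set.countable_univ_iff]
    have h : (Set.univ : Set (c.almostPrescribed F F')) =
        ⋃ y, {γ | (lamplighterHom n T).comp (c.twist e he) γ (0, v₀) = y} := by
      ext γ
      simp
    rw [h]
    exact Set.countable_iUnion fun y => (hprop (0, v₀) y).countable
  have : Countable (c.twist e he).range := (c.twist e he).rangeRestrict_surjective.countable
  refine isCocompactLattice_of_isCompact_isOpen (isOpen_lampStabilizer (0, v₀))
    (c.isCompact_lampStabilizer hT.connected n v₀) ?_ fun x => ?_
  · refine ((hprop (0, v₀) (0, v₀)).image (c.twist e he).rangeRestrict).subset ?_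
    rintro ⟨_, γ, rfl⟩ h
    exact ⟨γ, h, rfl⟩
  · obtain ⟨γ, h1, h2⟩ := c.exists_twist_vertex_eq e he hT hFF' horb 0
      (lampProdPerm n T.vertexPerm x⁻¹ (0, v₀)).1 v₀ (lampProdPerm n T.vertexPerm x⁻¹ (0, v₀)).2
    have h3 : lampProdPerm n T.vertexPerm (c.twist e he γ) (0, v₀) =
        lampProdPerm n T.vertexPerm x⁻¹ (0, v₀) := Prod.ext h2 h1
    refine ⟨x * c.twist e he γ, ?_, (c.twist e he γ)⁻¹, inv_mem ⟨γ, rfl⟩, by simp⟩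
    rw [mem_lampStabilizer, map_mul, Equiv.Perm.mul_apply, h3, ← Equiv.Perm.mul_apply,
      ← map_mul, mul_inv_cancel, map_one, Equiv.Perm.one_apply]

/-- If the projection to `Aut(T)` were discrete, its intersection with the compact stabilizer of a
vertex would be finite; but it moves the zero configuration to every other one. -/
theorem isIrreducible_twist [Fintype Ω] (hΩ : 2 ≤ Fintype.card Ω) (hn : 2 ≤ n) (hT : T.IsTree)
    (hFF' : F ≤ F') (horb : PreservesOrbitsOf F' F) :
    IsIrreducibleInWreath (c.twist e he).range := by
  intro hdisc
  have hpos : 0 < Fintype.card Ω := by lia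
  have : Nonempty Ω := Fintype.card_pos_iff.1 hpos
  have : Infinite V := c.infinite_vertices hT hΩ
  have : Nontrivial (Fin n) := Fin.nontrivial_iff_two_le.2 hn
  obtain ⟨v₀⟩ := hT.connected.nonempty
  let _ : TopologicalSpace V := ⊥
  have : DiscreteTopology V := ⟨rfl⟩
  have hemb : Topology.IsEmbedding (fun g : T ≃g T => (g : V → V)) :=
    ⟨⟨rfl⟩, DFunLike.coe_injective⟩
  have : IsTopologicalGroup (T ≃g T) :=
    isTopologicalGroup_of_isInducing_perm T.vertexPerm hemb.isInducing
  have : T2Space (T ≃g T) := hemb.t2Space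
  have hclosed := Subgroup.isClosed_of_discrete
    (H := (c.twist e he).range.map SemidirectProduct.rightHom)
  have hfin : ({g : T ≃g T | g v₀ = v₀} ∩
      ((c.twist e he).range.map SemidirectProduct.rightHom : Subgroup (T ≃g T))).Finite := by
    refine ((c.isCompact_stabilizer hT.connected v₀).inter_right hclosed).finite ?_
    exact IsDiscrete.mono ⟨hdisc⟩ Set.inter_subset_right
  choose γ h1 h2 using fun f => c.exists_twist_vertex_eq e he hT hFF' horb 0 f v₀ v₀
  refine Set.infinite_of_injective_forall_mem (f := fun f => (γ f).1) ?_ ?_ hfin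
  · intro f f' h
    rw [← h2 f, ← h2 f', Subtype.ext h]
  · intro f
    exact ⟨h1 f, _, ⟨γ f, rfl⟩, rfl⟩

end LegalColoring

/-! ### Cayley graphs of groups acting simply transitively on a graph -/

section Cayley

variable {G H W : Type*} [Group G] [Group H] {Y : SimpleGraph W}

/-- Induction along the edges of a connected graph. -/
theorem SimpleGraph.Connected.adj_induction (hY : Y.Connected) {P : W → Prop} {y₀ : W} (h0 : P y₀)
    (h : ∀ y z, Y.Adj y z → P y → P z) (y : W) : P y := by
  obtain ⟨p⟩ := hY.preconnected y y₀
  induction p with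
  | nil => exact h0
  | cons hadj _ ih => exact h _ _ hadj.symm (ih h0)

/-- A group acting on a connected graph is transitive on vertices as soon as the orbit of a vertex
contains all its neighbours. -/
theorem orbitMap_surjective_of_adj (hY : Y.Connected) (ρ : G →* (Y ≃g Y)) {y₀ : W}
    (h : ∀ y, Y.Adj y₀ y → ∃ g, ρ g y₀ = y) : Function.Surjective fun g => ρ g y₀ := by
  refine hY.adj_induction (y₀ := y₀) ⟨1, by simp⟩ ?_
  rintro y z hyz ⟨g, rfl⟩
  obtain ⟨k, hk⟩ := h (ρ g⁻¹ z) (by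
    rw [← (ρ g).map_adj_iff, map_inv, RelIso.apply_inv_self]
    exact hyz)
  refine ⟨g * k, ?_⟩
  beta_reduce
  rw [map_mul, RelIso.mul_apply, hk, map_inv, RelIso.apply_inv_self]

theorem orbitMap_injective_of_stabilizer (ρ : G →* (Y ≃g Y)) {y₀ : W}
    (h : ∀ g, ρ g y₀ = y₀ → g = 1) : Function.Injective fun g => ρ g y₀ := by
  intro g k hgk
  refine inv_mul_eq_one.1 (h _ ?_)
  have hgk' : ρ k y₀ = ρ g y₀ := hgk.symm
  rw [map_mul, RelIso.mul_apply, hgk', map_inv, RelIso.inv_apply_self]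

theorem closure_eq_top_of_orbitMap_bijective (hY : Y.Connected) (ρ : G →* (Y ≃g Y)) {y₀ : W}
    (h : Function.Bijective fun g => ρ g y₀) :
    Subgroup.closure {g | Y.Adj y₀ (ρ g y₀)} = ⊤ := by
  rw [Subgroup.eq_top_iff']
  have key : ∀ y, ∃ g ∈ Subgroup.closure {g | Y.Adj y₀ (ρ g y₀)}, ρ g y₀ = y := by
    refine hY.adj_induction (y₀ := y₀) ⟨1, one_mem _, by simp⟩ ?_
    rintro y z hyz ⟨g, hg, rfl⟩
    obtain ⟨k, rfl⟩ := h.2 z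
    refine ⟨g * (g⁻¹ * k), mul_mem hg (Subgroup.subset_closure ?_), by simp⟩
    rw [Set.mem_ofPred_eq, ← (ρ g).map_adj_iff, map_mul, RelIso.mul_apply, map_inv,
      RelIso.apply_inv_self]
    exact hyz
  intro g
  obtain ⟨k, hk, hkg⟩ := key (ρ g y₀)
  exact h.1 hkg ▸ hk

/-- A group acting simply transitively on the vertices of a graph has this graph as a Cayley
graph. -/
theorem nonempty_mulCayley_iso_of_orbitMap_bijective (ρ : G →* (Y ≃g Y)) {y₀ : W}
    (h : Function.Bijective fun g => ρ g y₀) :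
    Nonempty (SimpleGraph.mulCayley {g | Y.Adj y₀ (ρ g y₀)} ≃g Y) := by
  have key : ∀ g k, Y.Adj y₀ (ρ (g⁻¹ * k) y₀) ↔ Y.Adj (ρ g y₀) (ρ k y₀) := by
    intro g k
    rw [← (ρ g).map_adj_iff, map_mul, RelIso.mul_apply, map_inv, RelIso.apply_inv_self]
  refine ⟨⟨Equiv.ofBijective _ h, fun {g k} => ?_⟩⟩
  change Y.Adj (ρ g y₀) (ρ k y₀) ↔ _
  rw [SimpleGraph.mulCayley_adj']
  constructor
  · intro hadj
    refine ⟨?_, g⁻¹ * k, (key g k).2 hadj, Or.inl (by simp)⟩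
    rintro rfl
    exact hadj.ne rfl
  · rintro ⟨-, s, hs, rfl | rfl⟩
    · rw [← key, inv_mul_cancel_left]
      exact hs
    · rw [SimpleGraph.adj_comm, ← key, inv_mul_cancel_left]
      exact hs

/-- Two groups acting simply transitively on the vertices of the same connected locally finite graph
have isometric Cayley graphs. -/
theorem haveIsometricCayleyGraphs_of_simplyTransitive (hY : Y.Connected) {y₀ : W}
    (hfin : {y | Y.Adj y₀ y}.Finite) (ρ : G →* (Y ≃g Y)) (τ : H →* (Y ≃g Y))
    (hρ : Function.Bijective fun g => ρ g y₀) (hτ : Function.Bijective fun g => τ g y₀) :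
    HaveIsometricCayleyGraphs G H := by
  obtain ⟨iso₁⟩ := nonempty_mulCayley_iso_of_orbitMap_bijective ρ hρ
  obtain ⟨iso₂⟩ := nonempty_mulCayley_iso_of_orbitMap_bijective τ hτ
  exact ⟨_, _, hfin.preimage hρ.1.injOn, hfin.preimage hτ.1.injOn,
    closure_eq_top_of_orbitMap_bijective hY ρ hρ, closure_eq_top_of_orbitMap_bijective hY τ hτ,
    ⟨iso₁.trans iso₂.symm⟩⟩

end Cayley

/-! ### Bipartitions and edges -/

/-- This holds because two proper colorings with two colors of a connected graph are equal as soon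
as they agree at a vertex. -/
theorem mem_bipartitionPreserving_of_fixes {V : Type*} {T : SimpleGraph V} (hT : T.Connected)
    {g : T ≃g T} {v : V} (hv : g v = v) : g ∈ bipartitionPreserving T := by
  intro C
  refine hT.adj_induction (y₀ := v) (by rw [hv]) ?_
  intro y z hyz hy
  have h1 : C y ≠ C z := C.valid hyz
  have h2 : C (g y) ≠ C (g z) := C.valid (g.map_adj_iff.2 hyz)
  rw [hy] at h2
  exact (Bool.eq_not_of_ne h2.symm).trans (Bool.eq_not_of_ne h1.symm).symm

/-- An automorphism of a tree which preserves the bipartition and an edge fixes both ends of this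
edge. -/
theorem fixes_of_mem_bipartitionPreserving {V : Type*} {T : SimpleGraph V} (hT : T.IsTree)
    {g : T ≃g T} (hg : g ∈ bipartitionPreserving T) {a : T.edgeSet} (ha : T.edgePerm g a = a)
    {v : V} (hv : v ∈ (a : Sym2 V)) : g v = v := by
  have C : T.Coloring Bool := T.recolorOfEquiv finTwoEquiv hT.coloringTwo
  have hgv : g v ∈ (a : Sym2 V) := by
    rw [← ha]
    exact SimpleGraph.mem_edgePerm_iff.2 hv
  by_contra hne
  have hadj : T.Adj (g v) v := by
    have := a.2
    rwa [(Sym2.mem_and_mem_iff hne).1 ⟨hgv, hv⟩] at this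
  exact C.valid hadj (hg C v)

namespace LegalColoring

variable {V Ω : Type*} {T : SimpleGraph V} (c : LegalColoring T Ω)

/-- The edge with color `a` at the vertex `v`. -/
noncomputable def edge (v : V) (a : Ω) : T.edgeSet := ⟨s(v, c.nbr v a), c.adj_nbr v a⟩

theorem mem_edge (v : V) (a : Ω) : v ∈ (c.edge v a : Sym2 V) := Sym2.mem_mk_left _ _

theorem exists_edge_eq {a : T.edgeSet} {v : V} (hv : v ∈ (a : Sym2 V)) : ∃ i, a = c.edge v i := by
  obtain ⟨a, ha⟩ := a
  obtain ⟨w, rfl⟩ := Sym2.mem_iff_exists.1 hv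
  obtain ⟨i, hi⟩ := c.exists_nbr_eq (w := v) (u := w) ha
  refine ⟨i, Subtype.ext ?_⟩
  subst hi
  rfl

theorem edgePerm_edge (g : T ≃g T) (v : V) (a : Ω) :
    T.edgePerm g (c.edge v a) = c.edge (g v) (c.localPerm g v a) := by
  apply Subtype.ext
  change s(g v, g (c.nbr v a)) = s(g v, c.nbr (g v) (c.localPerm g v a))
  rw [map_nbr]

theorem edge_injective (v : V) : Function.Injective (c.edge v) := by
  intro a b h
  exact c.nbr_injective v (Sym2.congr_right.1 (congrArg Subtype.val h))

/-- The same edge, seen from its other end. -/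
theorem edge_nbr (v : V) (a : Ω) : c.edge (c.nbr v a) a = c.edge v a := by
  apply Subtype.ext
  change s(c.nbr v a, c.nbr (c.nbr v a) a) = s(v, c.nbr v a)
  rw [nbr_nbr]
  exact Sym2.eq_swap

theorem lampEdgeGraph_connected (c : LegalColoring T Ω) (n : ℕ) [NeZero n] [Nonempty Ω]
    (hT : T.Connected) :
    (lampEdgeGraph n T).Connected := by
  classical
  obtain ⟨v₀⟩ := hT.nonempty
  obtain ⟨i₀⟩ := ‹Nonempty Ω›
  have hstep : ∀ (f f' : V →₀ Fin n) (a a' : T.edgeSet) (v : V), v ∈ (a : Sym2 V) →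
      v ∈ (a' : Sym2 V) → (∀ w, w ≠ v → f w = f' w) →
      (lampEdgeGraph n T).Reachable (f, a) (f', a') := by
    intro f f' a a' v ha ha' h
    by_cases heq : ((f, a) : (V →₀ Fin n) × T.edgeSet) = (f', a')
    · rw [heq]
    · exact SimpleGraph.Adj.reachable ⟨heq, v, ha, ha', h⟩
  -- The edge can be moved anywhere without changing the lamps.
  have hmove : ∀ (f : V →₀ Fin n) (v : V) (i : Ω),
      (lampEdgeGraph n T).Reachable (f, c.edge v₀ i₀) (f, c.edge v i) := by
    intro f
    refine c.nbr_induction hT (v := v₀) ?_ ?_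
    · exact fun i => hstep f f _ _ v₀ (c.mem_edge _ _) (c.mem_edge _ _) fun _ _ => rfl
    · intro w b ih i
      refine (ih b).trans (hstep f f _ _ (c.nbr w b) ?_ (c.mem_edge _ _) fun _ _ => rfl)
      rw [← edge_nbr]
      exact c.mem_edge _ _
  -- To change the lamp at `v`, the edge is moved to `v` and back.
  have hlamp : ∀ f : V →₀ Fin n,
      (lampEdgeGraph n T).Reachable (0, c.edge v₀ i₀) (f, c.edge v₀ i₀) := by
    intro f
    induction f using Finsupp.induction with
    | zero => rfl
    | single_add v x f hv hx ih =>
      refine (ih.trans (hmove f v i₀)).trans (SimpleGraph.Reachable.trans ?_ (hmove _ v i₀).symm)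
      refine hstep _ _ _ _ v (c.mem_edge _ _) (c.mem_edge _ _) fun w hw => ?_
      rw [Finsupp.add_apply, Finsupp.single_eq_of_ne hw, zero_add]
  have hall : ∀ y, (lampEdgeGraph n T).Reachable (0, c.edge v₀ i₀) y := by
    rintro ⟨f, a⟩
    obtain ⟨v, hv⟩ : ∃ v, v ∈ (a : Sym2 V) := ⟨_, Sym2.out_fst_mem _⟩
    obtain ⟨i, rfl⟩ := c.exists_edge_eq hv
    exact (hlamp f).trans (hmove f v i)
  exact { preconnected := fun x y => (hall x).symm.trans (hall y), nonempty := ⟨(0, c.edge v₀ i₀)⟩ }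

variable (n : ℕ) [NeZero n]

theorem finite_lampEdgeGraph_adj [Finite Ω] (v₀ : V) (i₀ : Ω) :
    {y | (lampEdgeGraph n T).Adj (0, c.edge v₀ i₀) y}.Finite := by
  classical
  have h1 : {v | v ∈ (c.edge v₀ i₀ : Sym2 V)}.Finite := by
    refine (Set.toFinite {v₀, c.nbr v₀ i₀}).subset fun v hv => ?_
    exact Sym2.mem_iff.1 hv
  refine (h1.biUnion (t := fun v => Set.range fun p : Fin n × Ω =>
    (Finsupp.single v p.1, c.edge v p.2)) fun v _ => Set.finite_range _).subset ?_
  rintro ⟨f, a⟩ ⟨-, v, hv, ha, h⟩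
  obtain ⟨i, rfl⟩ := c.exists_edge_eq ha
  refine Set.mem_biUnion hv ⟨(f v, i), Prod.ext ?_ rfl⟩
  ext w : 1
  by_cases hw : w = v
  · rw [hw]
    exact Finsupp.single_eq_same
  · exact (Finsupp.single_eq_of_ne hw).trans (h w hw)

variable {n} {F F' : Subgroup (Equiv.Perm Ω)} (e : (F' ⧸ F.subgroupOf F') ≃ Fin n)
  (he : e ((1 : F') : F' ⧸ F.subgroupOf F') = 0)

/-- The action of `G(F, F')*` on `lampEdgeGraph n T`. -/
noncomputable def starLampEdgeHom :
    c.almostPrescribedStar F F' →* (lampEdgeGraph n T ≃g lampEdgeGraph n T) :=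
  (lampEdgeHom n T).comp ((c.twist e he).comp (Subgroup.inclusion inf_le_left))

/-- `G(F, F')*` acts simply transitively on the vertices of `lampEdgeGraph n T`. It is transitive
since the neighbours of a vertex are reached by elements fixing an end of the edge, with a local
permutation there which is prescribed on one color and on `F' ⧸ F`. -/
theorem starLampEdgeHom_bijective (hT : T.IsTree) (hFF' : F ≤ F') (horb : PreservesOrbitsOf F' F)
    (hF : IsRegularPermGroup F) (v₀ : V) (i₀ : Ω) :
    Function.Bijective fun g => c.starLampEdgeHom e he g (0, c.edge v₀ i₀) := by
  have : Nonempty Ω := ⟨i₀⟩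
  constructor
  · refine orbitMap_injective_of_stabilizer _ fun g hg => ?_
    have h1 : T.edgePerm g.1 (c.edge v₀ i₀) = c.edge v₀ i₀ := congrArg Prod.snd hg
    have h2 : g.1 v₀ = v₀ := fixes_of_mem_bipartitionPreserving hT g.2.2 h1 (c.mem_edge _ _)
    have h3 : c.localPerm g.1 v₀ i₀ = i₀ := by
      rw [edgePerm_edge, h2] at h1
      exact c.edge_injective _ h1
    have h4 := c.eq_one_of_twist_fixes e he hT.connected hF.2
      (γ := Subgroup.inclusion inf_le_left g) (congrArg Prod.fst hg) h2 h3
    exact Subtype.ext (congrArg (fun γ : c.almostPrescribed F F' => γ.1) h4)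
  · refine orbitMap_surjective_of_adj (c.lampEdgeGraph_connected n hT.connected) _ ?_
    rintro ⟨f, a⟩ ⟨-, v, hv, ha, h⟩
    obtain ⟨i, hi⟩ := c.exists_edge_eq hv
    obtain ⟨j, rfl⟩ := c.exists_edge_eq ha
    obtain ⟨s, hs1, hs2⟩ := exists_cosetHom_eq e hFF' horb (a := i) (b := j)
      (hF.1.exists_smul_eq i j) ((0 : V →₀ Fin n) v) (f v)
    obtain ⟨γ, h1, h2, h3⟩ := c.exists_twist_apply_eq e he hT hFF' horb 0 f hs2
    refine ⟨⟨γ.1, γ.2, mem_bipartitionPreserving_of_fixes hT.connected h1⟩, Prod.ext h3 ?_⟩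
    change T.edgePerm γ.1 (c.edge v₀ i₀) = c.edge v j
    have hi' : c.edge v₀ i₀ = c.edge v i := hi
    rw [hi', edgePerm_edge, h1, h2, hs1]

end LegalColoring

/-! ### The free product acting on the tree -/

/-- In a tree, at most one neighbour of a vertex `u` is closer to `x` than `u`. -/
theorem SimpleGraph.IsTree.eq_of_adj_of_dist_lt {V : Type*} {T : SimpleGraph V} (hT : T.IsTree)
    {u v v' x : V} (h : T.Adj u v) (h' : T.Adj u v') (hd : T.dist v x < T.dist u x)
    (hd' : T.dist v' x < T.dist u x) : v = v' := by
  obtain ⟨p, hp, hpl⟩ := hT.connected.exists_path_of_dist u x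
  have key : ∀ {w} (hw : T.Adj u w), T.dist w x < T.dist u x →
      ∃ q : T.Walk w x, p = .cons hw q := by
    intro w hw hdw
    obtain ⟨q, hq, hql⟩ := hT.connected.exists_path_of_dist w x
    rcases hT.path_cons_or hw hp hq with h1 | h1
    · exact ⟨q, h1⟩
    · have h2 := congrArg SimpleGraph.Walk.length h1
      rw [SimpleGraph.Walk.length_cons] at h2
      lia
  obtain ⟨q, hq⟩ := key h hd
  obtain ⟨q', hq'⟩ := key h' hd'
  rw [hq] at hq'
  injection hq'

theorem SimpleGraph.Iso.dist_map {V : Type*} {T : SimpleGraph V} (hT : T.Connected) (g : T ≃g T)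
    (x y : V) : T.dist (g x) (g y) = T.dist x y := by
  have key : ∀ (g : T ≃g T) (x y : V), T.dist (g x) (g y) ≤ T.dist x y := by
    intro g x y
    obtain ⟨p, hp⟩ := hT.exists_walk_length_eq_dist x y
    rw [← hp, ← p.length_map g.toHom]
    exact SimpleGraph.dist_le _
  refine le_antisymm (key g x y) ?_
  have h := key g⁻¹ (g x) (g y)
  rwa [RelIso.inv_apply_self, RelIso.inv_apply_self] at h

/-- An automorphism of a tree which fixes `u` and moves its neighbour `v` maps the half-tree on the
side of `v` into the half-tree on the side of `u`. -/
theorem SimpleGraph.IsTree.dist_lt_of_fixes {V : Type*} {T : SimpleGraph V} (hT : T.IsTree)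
    {u v w : V} (h : T.Adj u v) {g : T ≃g T} (hu : g u = u) (hv : g v ≠ v)
    (hd : T.dist v w < T.dist u w) : T.dist u (g w) < T.dist v (g w) := by
  have hdist : ∀ x y, T.dist (g x) (g y) = T.dist x y := g.dist_map hT.connected
  by_contra hcon
  have hne : T.dist u (g w) ≠ T.dist v (g w) := by
    rw [SimpleGraph.dist_comm, SimpleGraph.dist_comm (u := v)]
    exact hT.dist_ne_of_adj (g w) h
  have h1 : T.dist (g v) (g w) < T.dist u (g w) := by
    have h2 := hdist u w
    rw [hu] at h2
    rw [hdist, h2]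
    exact hd
  have h2 : T.Adj u (g v) := by
    have := g.map_adj_iff.2 h
    rwa [hu] at this
  exact hv (hT.eq_of_adj_of_dist_lt h2 h h1 (by lia))

/-- Ping-pong for a free product of two copies of a group. -/
theorem Monoid.Coprod.lift_injective_of_ping_pong {A G α : Type*} [Group A] [Group G]
    [MulAction G α] (f₀ f₁ : A →* G) (hA : 3 ≤ Cardinal.mk A) {X₀ X₁ : Set α}
    (h₀ : X₀.Nonempty) (h₁ : X₁.Nonempty) (hdisj : Disjoint X₀ X₁)
    (hf₀ : ∀ a ≠ 1, ∀ x ∈ X₁, f₀ a • x ∈ X₀) (hf₁ : ∀ a ≠ 1, ∀ x ∈ X₀, f₁ a • x ∈ X₁) :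
    Function.Injective (Monoid.Coprod.lift f₀ f₁) := by
  let f : ∀ _ : Bool, A →* G := fun i => Bool.rec f₀ f₁ i
  let X : Bool → Set α := fun i => Bool.rec X₀ X₁ i
  have hinj : Function.Injective (Monoid.CoprodI.lift f) := by
    refine Monoid.CoprodI.lift_injective_of_ping_pong f (Or.inr ⟨false, hA⟩) X ?_ ?_ ?_
    · rintro (_ | _)
      exacts [h₀, h₁]
    · rintro (_ | _) (_ | _) hne
      exacts [(hne rfl).elim, hdisj, hdisj.symm, (hne rfl).elim]
    · rintro (_ | _) (_ | _) hne a ha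
      · exact (hne rfl).elim
      · rintro _ ⟨x, hx, rfl⟩
        exact hf₀ a ha x hx
      · rintro _ ⟨x, hx, rfl⟩
        exact hf₁ a ha x hx
      · exact (hne rfl).elim
  -- The binary free product embeds into the indexed one, as `k` inverts `j`.
  let j : Monoid.Coprod A A →* Monoid.CoprodI (fun _ : Bool => A) :=
    Monoid.Coprod.lift (Monoid.CoprodI.of (M := fun _ : Bool => A) (i := false))
      (Monoid.CoprodI.of (M := fun _ : Bool => A) (i := true))
  let k : Monoid.CoprodI (fun _ : Bool => A) →* Monoid.Coprod A A :=
    Monoid.CoprodI.lift fun i => Bool.rec Monoid.Coprod.inl Monoid.Coprod.inr i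
  have hkj : k.comp j = MonoidHom.id _ := by
    apply Monoid.Coprod.hom_ext <;> ext a <;> simp [k, j]
  have hfj : (Monoid.CoprodI.lift f).comp j = Monoid.Coprod.lift f₀ f₁ := by
    apply Monoid.Coprod.hom_ext <;> ext a <;> simp [f, j]
  rw [← hfj]
  exact hinj.comp (Function.LeftInverse.injective (g := k) fun x => DFunLike.congr_fun hkj x)

namespace LegalColoring

variable {V Ω : Type*} {T : SimpleGraph V} (c : LegalColoring T Ω)

theorem aut_ext (hT : T.Connected) {g h : T ≃g T} {v : V} (hv : g v = h v)
    (hgh : ∀ w, c.localPerm g w = c.localPerm h w) : g = h := by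
  ext w
  refine c.nbr_induction hT (P := fun w => g w = h w) hv (fun w a hw => ?_) w
  rw [map_nbr, map_nbr, hw, hgh]

theorem exists_rotation (hT : T.IsTree) (v : V) (s : Equiv.Perm Ω) :
    ∃ g : T ≃g T, g v = v ∧ ∀ w, c.localPerm g w = s := by
  obtain ⟨g, hv, -, hg⟩ := c.exists_aut hT (R := fun _ _ p => p = s) (v := v) (v' := v) (s := s)
    (fun _ _ p hp _ => ⟨p, hp, rfl⟩) rfl
  exact ⟨g, hv, hg⟩

/-- The automorphism fixing `v` all of whose local permutations are equal to `s`. -/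
noncomputable def rotation (hT : T.IsTree) (v : V) : Equiv.Perm Ω →* (T ≃g T) where
  toFun s := (c.exists_rotation hT v s).choose
  map_one' := by
    have h := (c.exists_rotation hT v 1).choose_spec
    exact c.aut_ext hT.connected h.1 fun w => (h.2 w).trans (c.localPerm_one w).symm
  map_mul' s t := by
    have h := (c.exists_rotation hT v (s * t)).choose_spec
    have hs := (c.exists_rotation hT v s).choose_spec
    have ht := (c.exists_rotation hT v t).choose_spec
    refine c.aut_ext hT.connected (v := v) ?_ fun w => ?_
    · rw [RelIso.mul_apply, h.1, ht.1, hs.1]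
    · rw [localPerm_mul, h.2, hs.2, ht.2]

theorem rotation_apply (hT : T.IsTree) (v : V) (s : Equiv.Perm Ω) : c.rotation hT v s v = v :=
  (c.exists_rotation hT v s).choose_spec.1

theorem localPerm_rotation (hT : T.IsTree) (v : V) (s : Equiv.Perm Ω) (w : V) :
    c.localPerm (c.rotation hT v s) w = s := (c.exists_rotation hT v s).choose_spec.2 w

section FreeProduct

variable {A : Type*} [Group A] (r : A →* Equiv.Perm Ω) (hT : T.IsTree) (v₀ : V) (i₀ : Ω)

/-- The action on the tree of the free product of two copies of a group `A` acting on the set of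
colors: the two free factors act by rotations around the two ends of an edge. -/
noncomputable def freeProductHom : Monoid.Coprod A A →* (T ≃g T) :=
  Monoid.Coprod.lift ((c.rotation hT v₀).comp r) ((c.rotation hT (c.nbr v₀ i₀)).comp r)

theorem freeProductHom_inl (a : A) :
    c.freeProductHom r hT v₀ i₀ (.inl a) = c.rotation hT v₀ (r a) :=
  Monoid.Coprod.lift_apply_inl _ _ a

theorem freeProductHom_inr (a : A) :
    c.freeProductHom r hT v₀ i₀ (.inr a) = c.rotation hT (c.nbr v₀ i₀) (r a) :=
  Monoid.Coprod.lift_apply_inr _ _ a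

theorem freeProductHom_mem_bipartitionPreserving (p : Monoid.Coprod A A) :
    c.freeProductHom r hT v₀ i₀ p ∈ bipartitionPreserving T := by
  induction p using Monoid.Coprod.induction_on with
  | inl a =>
    rw [freeProductHom_inl]
    exact mem_bipartitionPreserving_of_fixes hT.connected (c.rotation_apply hT _ _)
  | inr a =>
    rw [freeProductHom_inr]
    exact mem_bipartitionPreserving_of_fixes hT.connected (c.rotation_apply hT _ _)
  | mul p q hp hq =>
    rw [map_mul]
    exact mul_mem hp hq

/-- The local permutations of an element of the free product are all equal. -/
theorem exists_localPerm_freeProductHom (p : Monoid.Coprod A A) :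
    ∃ a, ∀ w, c.localPerm (c.freeProductHom r hT v₀ i₀ p) w = r a := by
  induction p using Monoid.Coprod.induction_on with
  | inl a => exact ⟨a, fun w => by rw [freeProductHom_inl, localPerm_rotation]⟩
  | inr a => exact ⟨a, fun w => by rw [freeProductHom_inr, localPerm_rotation]⟩
  | mul p q hp hq =>
    obtain ⟨a, ha⟩ := hp
    obtain ⟨b, hb⟩ := hq
    exact ⟨a * b, fun w => by rw [map_mul, localPerm_mul, ha, hb, map_mul]⟩

/-- Ping-pong on the two half-trees obtained by removing the edge with color `i₀` at `v₀`. -/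
theorem freeProductHom_injective (hA : 3 ≤ Cardinal.mk A) (hr : ∀ a i, r a i = i → a = 1) :
    Function.Injective (c.freeProductHom r hT v₀ i₀) := by
  have hadj := c.adj_nbr v₀ i₀
  refine Monoid.Coprod.lift_injective_of_ping_pong _ _ hA
    (X₀ := {w | T.dist v₀ w < T.dist (c.nbr v₀ i₀) w})
    (X₁ := {w | T.dist (c.nbr v₀ i₀) w < T.dist v₀ w}) ⟨v₀, ?_⟩ ⟨c.nbr v₀ i₀, ?_⟩ ?_ ?_ ?_
  · rw [Set.mem_ofPred_eq, SimpleGraph.dist_self, SimpleGraph.dist_eq_one_iff_adj.2 hadj.symm]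
    exact one_pos
  · rw [Set.mem_ofPred_eq, SimpleGraph.dist_self, SimpleGraph.dist_eq_one_iff_adj.2 hadj]
    exact one_pos
  · exact Set.disjoint_left.2 fun w h h' =>
      lt_asymm (a := T.dist v₀ w) h h'
  · intro a ha w hw
    refine hT.dist_lt_of_fixes hadj (c.rotation_apply hT _ _) (fun h => ha (hr a i₀ ?_)) hw
    change c.rotation hT v₀ (r a) _ = _ at h
    rw [map_nbr, rotation_apply, localPerm_rotation] at h
    exact c.nbr_injective _ h
  · intro a ha w hw
    refine hT.dist_lt_of_fixes hadj.symm (c.rotation_apply hT _ _) (fun h => ha (hr a i₀ ?_)) hw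
    change c.rotation hT (c.nbr v₀ i₀) (r a) v₀ = v₀ at h
    rw [← c.nbr_nbr v₀ i₀, map_nbr, nbr_nbr, rotation_apply, localPerm_rotation] at h
    exact c.nbr_injective _ h

/-- The stabilizer of a vertex `v` is given by the rotations around `v`. -/
theorem freeProductHom_eq_rotation {p : Monoid.Coprod A A} {v : V}
    (h : c.freeProductHom r hT v₀ i₀ p v = v) :
    ∃ a, c.freeProductHom r hT v₀ i₀ p = c.rotation hT v (r a) := by
  obtain ⟨a, ha⟩ := c.exists_localPerm_freeProductHom r hT v₀ i₀ p
  refine ⟨a, c.aut_ext hT.connected (h.trans (c.rotation_apply hT _ _).symm) fun w => ?_⟩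
  rw [ha, localPerm_rotation]

/-- The equivariant map from the vertices of the Bass-Serre tree of `A * A` to the vertices of `T`
sending the two base cosets to the two ends of the base edge. -/
noncomputable def bassSerreMap :
    (Monoid.Coprod A A ⧸ (Monoid.Coprod.inl : A →* Monoid.Coprod A A).range) ⊕
      (Monoid.Coprod A A ⧸ (Monoid.Coprod.inr : A →* Monoid.Coprod A A).range) → V :=
  Sum.elim
    (fun x => Quotient.liftOn' x (fun p => c.freeProductHom r hT v₀ i₀ p v₀) (by
      intro p q hpq
      obtain ⟨a, ha⟩ := QuotientGroup.leftRel_apply.1 hpq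
      rw [← mul_inv_cancel_left p q, ← ha, map_mul, freeProductHom_inl, RelIso.mul_apply,
        rotation_apply]))
    (fun x => Quotient.liftOn' x (fun p => c.freeProductHom r hT v₀ i₀ p (c.nbr v₀ i₀)) (by
      intro p q hpq
      obtain ⟨a, ha⟩ := QuotientGroup.leftRel_apply.1 hpq
      rw [← mul_inv_cancel_left p q, ← ha, map_mul, freeProductHom_inr, RelIso.mul_apply,
        rotation_apply]))

theorem bassSerreMap_inl (p : Monoid.Coprod A A) :
    c.bassSerreMap r hT v₀ i₀ (.inl p) = c.freeProductHom r hT v₀ i₀ p v₀ := rfl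

theorem bassSerreMap_inr (p : Monoid.Coprod A A) :
    c.bassSerreMap r hT v₀ i₀ (.inr p) = c.freeProductHom r hT v₀ i₀ p (c.nbr v₀ i₀) := rfl

theorem bassSerreMap_smul (p : Monoid.Coprod A A)
    (x : (Monoid.Coprod A A ⧸ (Monoid.Coprod.inl : A →* Monoid.Coprod A A).range) ⊕
      (Monoid.Coprod A A ⧸ (Monoid.Coprod.inr : A →* Monoid.Coprod A A).range)) :
    c.bassSerreMap r hT v₀ i₀ (p • x) =
      c.freeProductHom r hT v₀ i₀ p (c.bassSerreMap r hT v₀ i₀ x) := by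
  rcases x with x | x <;> obtain ⟨q, rfl⟩ := QuotientGroup.mk_surjective x
  · rw [bassSerreMap_inl, ← RelIso.mul_apply, ← map_mul]
    rfl
  · rw [bassSerreMap_inr, ← RelIso.mul_apply, ← map_mul]
    rfl

/-- The tree `T` is the Bass-Serre tree of the free product `A * A` when `A` acts simply
transitively on the set of colors. -/
theorem bassSerreMap_bijective (hA : 3 ≤ Cardinal.mk A) (hr : ∀ a i, r a i = i → a = 1)
    (hr' : ∀ i, ∃ a, r a i₀ = i) : Function.Bijective (c.bassSerreMap r hT v₀ i₀) := by
  have hinj := c.freeProductHom_injective r hT v₀ i₀ hA hr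
  have hfix : ∀ {v : V} {p q : Monoid.Coprod A A},
      c.freeProductHom r hT v₀ i₀ p v = c.freeProductHom r hT v₀ i₀ q v →
      c.freeProductHom r hT v₀ i₀ (p⁻¹ * q) v = v := by
    intro v p q h
    rw [map_mul, RelIso.mul_apply, ← h, map_inv, RelIso.inv_apply_self]
  have hne : ∀ p q, c.freeProductHom r hT v₀ i₀ p v₀ ≠
      c.freeProductHom r hT v₀ i₀ q (c.nbr v₀ i₀) := by
    intro p q h
    have C : T.Coloring Bool := T.recolorOfEquiv finTwoEquiv hT.coloringTwo
    have h1 := c.freeProductHom_mem_bipartitionPreserving r hT v₀ i₀ p C v₀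
    have h2 := c.freeProductHom_mem_bipartitionPreserving r hT v₀ i₀ q C (c.nbr v₀ i₀)
    rw [h, h2] at h1
    exact C.valid (c.adj_nbr v₀ i₀) h1.symm
  constructor
  · rintro (x | x) (y | y) h <;> obtain ⟨p, rfl⟩ := QuotientGroup.mk_surjective x <;>
      obtain ⟨q, rfl⟩ := QuotientGroup.mk_surjective y
    · refine congrArg Sum.inl (QuotientGroup.eq.2 ?_)
      obtain ⟨a, ha⟩ := c.freeProductHom_eq_rotation r hT v₀ i₀ (hfix h)
      exact ⟨a, hinj (by rw [freeProductHom_inl, ha])⟩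
    · exact (hne p q h).elim
    · exact (hne q p h.symm).elim
    · refine congrArg Sum.inr (QuotientGroup.eq.2 ?_)
      obtain ⟨a, ha⟩ := c.freeProductHom_eq_rotation r hT v₀ i₀ (hfix h)
      exact ⟨a, hinj (by rw [freeProductHom_inr, ha])⟩
  · refine c.nbr_induction hT.connected (v := v₀) ⟨.inl (1 : Monoid.Coprod A A), ?_⟩ ?_
    · rw [bassSerreMap_inl, map_one]
      rfl
    · rintro w i ⟨x | x, rfl⟩ <;> obtain ⟨p, rfl⟩ := QuotientGroup.mk_surjective x
      · obtain ⟨b, hb⟩ := c.exists_localPerm_freeProductHom r hT v₀ i₀ p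
        obtain ⟨a, ha⟩ := hr' ((r b)⁻¹ i)
        refine ⟨.inr (p * .inl a : Monoid.Coprod A A), ?_⟩
        rw [bassSerreMap_inr, bassSerreMap_inl, map_mul, RelIso.mul_apply, freeProductHom_inl,
          map_nbr, rotation_apply, localPerm_rotation, ha, map_nbr, hb, ← Equiv.Perm.mul_apply,
          mul_inv_cancel, Equiv.Perm.one_apply]
      · obtain ⟨b, hb⟩ := c.exists_localPerm_freeProductHom r hT v₀ i₀ p
        obtain ⟨a, ha⟩ := hr' ((r b)⁻¹ i)
        refine ⟨.inl (p * .inr a : Monoid.Coprod A A), ?_⟩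
        have h1 : c.freeProductHom r hT v₀ i₀ (.inr a) v₀ =
            c.nbr (c.nbr v₀ i₀) (r a i₀) := by
          conv_lhs => rw [← c.nbr_nbr v₀ i₀]
          rw [freeProductHom_inr, map_nbr, nbr_nbr, rotation_apply, localPerm_rotation]
        rw [bassSerreMap_inr, bassSerreMap_inl, map_mul, RelIso.mul_apply, h1, ha, map_nbr, hb,
          ← Equiv.Perm.mul_apply, mul_inv_cancel, Equiv.Perm.one_apply]

end FreeProduct

end LegalColoring

/-! ### The wreath product over the free product and its Cayley graph -/

section RegularPerm

variable {A Ω : Type*} [Group A]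

/-- The left regular action of a group `A` on a set in bijection with `A`. -/
def regularPerm (ε : A ≃ Ω) : A →* Equiv.Perm Ω :=
  (Equiv.permCongrHom ε).toMonoidHom.comp (MulAction.toPermHom A A)

theorem regularPerm_apply (ε : A ≃ Ω) (a : A) (i : Ω) :
    regularPerm ε a i = ε (a * ε.symm i) := rfl

theorem eq_one_of_regularPerm_apply_eq (ε : A ≃ Ω) (a : A) (i : Ω) (h : regularPerm ε a i = i) :
    a = 1 := by
  rw [regularPerm_apply, ← Equiv.eq_symm_apply] at h
  exact mul_eq_right.1 h

theorem exists_regularPerm_apply_eq (ε : A ≃ Ω) (i j : Ω) : ∃ a, regularPerm ε a i = j :=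
  ⟨ε.symm j * (ε.symm i)⁻¹, by
    rw [regularPerm_apply, inv_mul_cancel_right, Equiv.apply_symm_apply]⟩

end RegularPerm

section WreathToLamp

variable {V : Type*} {T : SimpleGraph V} {n : ℕ} [NeZero n] {B X P : Type*} [Group B] [Group P]
  [MulAction P X] (β : B →* Equiv.Perm (Fin n)) (κ : P →* (T ≃g T)) (b : X ≃ V)
  (hb : ∀ p x, b (p • x) = κ p (b x))

/-- The morphism from `B ≀_X P` to `𝔖_n ≀ Aut(T)` induced by actions of `B` on `{0, …, n-1}` and of
`P` on `T`, where `X` is identified with the set of vertices of `T`. -/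
noncomputable def wreathToLamp : RestrictedWreath B X P →* LampGroup n T where
  toFun x := ⟨⟨fun v => β (x.left (b.symm v)), by
    refine (b.symm.injective.tendsto_cofinite.eventually x.left.2).mono fun v hv => ?_
    have hv' : x.left (b.symm v) = 1 := Subgroup.mem_bot.1 hv
    change β (x.left (b.symm v)) ∈ MulAction.stabilizer (Equiv.Perm (Fin n)) (0 : Fin n)
    rw [hv', map_one]
    exact one_mem _⟩, κ x.right⟩
  map_one' := by
    refine SemidirectProduct.ext ?_ (map_one κ)
    ext v : 1
    exact map_one β
  map_mul' x y := by
    refine SemidirectProduct.ext ?_ (map_mul κ _ _)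
    ext v : 1
    change β (x.left (b.symm v) * y.left (x.right⁻¹ • b.symm v)) =
      β (x.left (b.symm v)) * β (y.left (b.symm ((κ x.right)⁻¹ v)))
    have h : x.right⁻¹ • b.symm v = b.symm ((κ x.right)⁻¹ v) := by
      rw [Equiv.eq_symm_apply, hb, map_inv, Equiv.apply_symm_apply]
    rw [map_mul, h]

theorem wreathToLamp_left (x : RestrictedWreath B X P) (v : V) :
    (wreathToLamp β κ b hb x).left v = β (x.left (b.symm v)) := rfl

/-- If `B` acts simply transitively on the states of a lamp and `P` acts simply transitively on
a set, then `B ≀ P` acts simply transitively on the pairs of a lamp configuration and an element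
of this set. -/
theorem wreathToLamp_orbitMap_bijective (hβ : ∀ x i, β x i = i → x = 1)
    (hβ' : ∀ i, ∃ x, β x 0 = i) {Y : Type*} (ν : (T ≃g T) →* Equiv.Perm Y) {y₀ : Y}
    (h : Function.Bijective fun p => ν (κ p) y₀) :
    Function.Bijective fun x => lampProdPerm n ν (wreathToLamp β κ b hb x) (0, y₀) := by
  have happly : ∀ (x : RestrictedWreath B X P) (v : X),
      lampPerm n T (wreathToLamp β κ b hb x) 0 (b v) = β (x.left v) 0 := by
    intro x v
    rw [lampPerm_apply, wreathToLamp_left, Equiv.symm_apply_apply]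
    rfl
  constructor
  · intro x y hxy
    have h2 : ν (κ x.right) y₀ = ν (κ y.right) y₀ := congrArg Prod.snd hxy
    have h1 : lampPerm n T (wreathToLamp β κ b hb x) 0 = lampPerm n T (wreathToLamp β κ b hb y) 0 :=
      congrArg Prod.fst hxy
    refine SemidirectProduct.ext ?_ (h.1 h2)
    ext v : 1
    have h3 := DFunLike.congr_fun h1 (b v)
    rw [happly, happly] at h3
    refine (inv_mul_eq_one.1 (hβ _ 0 ?_)).symm
    rw [map_mul, Equiv.Perm.mul_apply, h3, map_inv, Equiv.Perm.inv_eq_iff_eq]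
  · rintro ⟨f, y⟩
    obtain ⟨p, hp⟩ := h.2 y
    choose t ht using hβ'
    have ht0 : t 0 = 1 := hβ _ 0 (ht 0)
    let x : RestrictedWreath B X P := ⟨⟨fun v => t (f (b v)), by
      refine (f.hasFiniteSupport.preimage (f := b) b.injective.injOn).subset fun v hv hcon => hv ?_
      change t (f (b v)) = 1
      rw [hcon, ht0]⟩, p⟩
    refine ⟨x, Prod.ext ?_ hp⟩
    ext w : 1
    obtain ⟨v, rfl⟩ := b.surjective w
    exact (happly x v).trans (ht _)

end WreathToLamp

namespace LegalColoring

variable {V Ω : Type*} {T : SimpleGraph V} (c : LegalColoring T Ω) {A : Type*} [Group A]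

/-- The free product of two copies of a group acting simply transitively on the colors acts simply
transitively on the edges of the tree. -/
theorem freeProductHom_edge_bijective (r : A →* Equiv.Perm Ω) (hT : T.IsTree) (v₀ : V) (i₀ : Ω)
    (hA : 3 ≤ Cardinal.mk A) (hr : ∀ a i, r a i = i → a = 1) (hr' : ∀ i j, ∃ a, r a i = j) :
    Function.Bijective fun p => T.edgePerm (c.freeProductHom r hT v₀ i₀ p) (c.edge v₀ i₀) := by
  constructor
  · intro p q hpq
    have hpq' : T.edgePerm (c.freeProductHom r hT v₀ i₀ q) (c.edge v₀ i₀) =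
      T.edgePerm (c.freeProductHom r hT v₀ i₀ p) (c.edge v₀ i₀) := hpq.symm
    have h1 : T.edgePerm (c.freeProductHom r hT v₀ i₀ (p⁻¹ * q)) (c.edge v₀ i₀) =
        c.edge v₀ i₀ := by
      rw [map_mul, map_mul, Equiv.Perm.mul_apply, hpq', map_inv, map_inv,
        Equiv.Perm.inv_eq_iff_eq]
    have h2 := fixes_of_mem_bipartitionPreserving hT
      (c.freeProductHom_mem_bipartitionPreserving r hT v₀ i₀ (p⁻¹ * q)) h1 (c.mem_edge v₀ i₀)
    obtain ⟨a, ha⟩ := c.freeProductHom_eq_rotation r hT v₀ i₀ h2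
    rw [edgePerm_edge, h2, ha, localPerm_rotation] at h1
    rw [hr a i₀ (c.edge_injective _ h1), map_one, map_one] at ha
    exact inv_mul_eq_one.1 (c.freeProductHom_injective r hT v₀ i₀ hA hr (ha.trans (map_one _).symm))
  · have key : ∀ w, ∀ i, ∃ p, T.edgePerm (c.freeProductHom r hT v₀ i₀ p) (c.edge v₀ i₀) =
        c.edge w i := by
      -- Rotating the base edge around one of its ends `v` before applying `p` gives every edge at
      -- the image of `v`.
      have hturn : ∀ p v i, v ∈ (c.edge v₀ i₀ : Sym2 V) → ∃ q,
          T.edgePerm (c.freeProductHom r hT v₀ i₀ q) (c.edge v₀ i₀) =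
            c.edge (c.freeProductHom r hT v₀ i₀ p v) i := by
        intro p v i hv
        obtain ⟨j, hj⟩ := c.exists_edge_eq hv
        obtain ⟨b, hb⟩ := c.exists_localPerm_freeProductHom r hT v₀ i₀ p
        obtain ⟨a, ha⟩ := hr' j ((r b)⁻¹ i)
        have hq : ∃ q, c.freeProductHom r hT v₀ i₀ q = c.rotation hT v (r a) := by
          rcases Sym2.mem_iff.1 hv with rfl | rfl
          · exact ⟨_, c.freeProductHom_inl r hT _ _ a⟩
          · exact ⟨_, c.freeProductHom_inr r hT _ _ a⟩
        obtain ⟨q, hq⟩ := hq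
        refine ⟨p * q, ?_⟩
        rw [map_mul, map_mul, Equiv.Perm.mul_apply, hq, hj, edgePerm_edge, edgePerm_edge,
          rotation_apply, localPerm_rotation, ha, hb, ← Equiv.Perm.mul_apply, mul_inv_cancel,
          Equiv.Perm.one_apply]
      refine c.nbr_induction hT.connected (v := v₀) ?_ ?_
      · intro i
        obtain ⟨q, hq⟩ := hturn 1 v₀ i (c.mem_edge _ _)
        rw [map_one] at hq
        exact ⟨q, hq⟩
      · intro w j hw i
        obtain ⟨p, hp⟩ := hw j
        have hmem : c.nbr w j ∈ (T.edgePerm (c.freeProductHom r hT v₀ i₀ p) (c.edge v₀ i₀) :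
            Sym2 V) := by
          rw [hp]
          exact Sym2.mem_mk_right _ _
        obtain ⟨v, hv, hvw⟩ := Sym2.mem_map.1
          (SimpleGraph.coe_edgePerm (T := T) _ _ ▸ hmem)
        obtain ⟨q, hq⟩ := hturn p v i hv
        exact ⟨q, by rw [hq, hvw]⟩
    intro a
    obtain ⟨i, hi⟩ := c.exists_edge_eq (Sym2.out_fst_mem (a : Sym2 V))
    obtain ⟨p, hp⟩ := key _ i
    exact ⟨p, hp.trans hi.symm⟩

/-- The Cayley graphs of `C_n ≀_V (C_d * C_d)` and `G(F, F')*`: both groups act simply transitively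
on the vertices of `lampEdgeGraph n T`. -/
theorem haveIsometricCayleyGraphs_almostPrescribedStar [Fintype Ω] {d n : ℕ} [NeZero n]
    (hd : 3 ≤ d) (hΩ : Fintype.card Ω = d) (hT : T.IsTree) {F F' : Subgroup (Equiv.Perm Ω)}
    (hFF' : F ≤ F') (hF : IsRegularPermGroup F) (horb : PreservesOrbitsOf F' F)
    (e : (F' ⧸ F.subgroupOf F') ≃ Fin n) (he : e ((1 : F') : F' ⧸ F.subgroupOf F') = 0) :
    HaveIsometricCayleyGraphs (LampCyclicGroup n d) (c.almostPrescribedStar F F') := by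
  have : NeZero d := ⟨by lia⟩
  have hpos : 0 < Fintype.card Ω := by lia
  obtain ⟨i₀⟩ : Nonempty Ω := Fintype.card_pos_iff.1 hpos
  have : Nonempty Ω := ⟨i₀⟩
  obtain ⟨v₀⟩ := hT.connected.nonempty
  have hcard : ∀ m [NeZero m], Fintype.card (CyclicGrp m) = m := fun m _ =>
    (Fintype.card_congr Multiplicative.toAdd).trans (ZMod.card m)
  let ε : CyclicGrp d ≃ Ω := Fintype.equivOfCardEq (by rw [hcard, hΩ])
  let δ : CyclicGrp n ≃ Fin n := Fintype.equivOfCardEq (by rw [hcard, Fintype.card_fin])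
  have hA : 3 ≤ Cardinal.mk (CyclicGrp d) := by
    rw [Cardinal.mk_fintype, hcard]
    exact_mod_cast hd
  let r := regularPerm ε
  have hr := eq_one_of_regularPerm_apply_eq ε
  have hr' := exists_regularPerm_apply_eq ε
  let b : BassSerreVertex d ≃ V := Equiv.ofBijective (c.bassSerreMap r hT v₀ i₀)
    (c.bassSerreMap_bijective r hT v₀ i₀ hA hr (hr' i₀))
  let ω := wreathToLamp (X := BassSerreVertex d) (regularPerm δ) (c.freeProductHom r hT v₀ i₀) b
    (c.bassSerreMap_smul r hT v₀ i₀)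
  refine haveIsometricCayleyGraphs_of_simplyTransitive
    (c.lampEdgeGraph_connected n hT.connected) (c.finite_lampEdgeGraph_adj n v₀ i₀)
    ((lampEdgeHom n T).comp ω) (c.starLampEdgeHom e he) ?_
    (c.starLampEdgeHom_bijective e he hT hFF' horb hF v₀ i₀)
  exact wreathToLamp_orbitMap_bijective (regularPerm δ) _ b _ (eq_one_of_regularPerm_apply_eq δ)
    (exists_regularPerm_apply_eq δ 0) T.edgePerm
    (c.freeProductHom_edge_bijective r hT v₀ i₀ hA hr hr')

end LegalColoring

/-! ### The semi-direct decomposition -/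

/-- A split extension of `Q` by `N` is a semi-direct product. -/
theorem exists_mulEquiv_semidirectProduct {Γ N Q : Type*} [Group Γ] [Group N] [Group Q]
    {ι : N →* Γ} (hι : Function.Injective ι) {π : Γ →* Q} (s : Q →* Γ) (hs : ∀ q, π (s q) = q)
    (hιπ : ι.range = π.ker) : ∃ θ : Q →* MulAut N, Nonempty (Γ ≃* N ⋊[θ] Q) := by
  let S : GroupExtension N Γ Q :=
    { inl := ι
      rightHom := π
      inl_injective := hι
      range_inl_eq_ker_rightHom := hιπ
      rightHom_surjective := fun q => ⟨s q, hs q⟩ }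
  let σ : S.Splitting := { s with rightInverse_rightHom := hs }
  exact ⟨σ.conjAct, ⟨σ.semidirectProductMulEquiv.symm⟩⟩

section FreeKernel

variable {A I : Type*} [Group A] (ε : I ≃ {a : A // a ≠ 1})

open Classical in
/-- The generators of the free group on `A ∖ {1}`, extended by the value `1` at `1`. -/
noncomputable def freeGen (a : A) : FreeGroup I :=
  if h : a = 1 then 1 else FreeGroup.of (ε.symm ⟨a, h⟩)

theorem freeGen_one : freeGen ε (1 : A) = 1 := by simp [freeGen]

theorem freeGen_coe (i : I) : freeGen ε (ε i : A) = FreeGroup.of i := by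
  simp [freeGen, (ε i).2]

/-- Two morphisms on the free group which agree on `freeGen ε` are equal. -/
theorem freeGroup_hom_ext_freeGen {M : Type*} [Group M] {f g : FreeGroup I →* M}
    (h : ∀ a, f (freeGen ε a) = g (freeGen ε a)) : f = g := by
  ext i
  rw [← freeGen_coe ε i]
  exact h _

/-- A morphism from the free group with prescribed values at `freeGen ε`. -/
theorem lift_freeGen {M : Type*} [Group M] (u : A → M) (hu : u 1 = 1) (a : A) :
    FreeGroup.lift (fun i => u (ε i)) (freeGen ε a) = u a := by
  by_cases h : a = 1
  · rw [h, freeGen_one, map_one, hu]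
  · simp [freeGen, h]

/-- The endomorphism `x_a ↦ x_{ba} x_b⁻¹` of the free group. -/
noncomputable def freeTwist (b : A) : FreeGroup I →* FreeGroup I :=
  FreeGroup.lift fun i => freeGen ε (b * ε i) * (freeGen ε b)⁻¹

theorem freeTwist_freeGen (b a : A) :
    freeTwist ε b (freeGen ε a) = freeGen ε (b * a) * (freeGen ε b)⁻¹ :=
  lift_freeGen ε (fun a => freeGen ε (b * a) * (freeGen ε b)⁻¹) (by simp) a

theorem freeTwist_mul (b c : A) (k : FreeGroup I) :
    freeTwist ε (b * c) k = freeTwist ε b (freeTwist ε c k) := by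
  refine DFunLike.congr_fun (freeGroup_hom_ext_freeGen (g := (freeTwist ε b).comp (freeTwist ε c))
    ε fun a => ?_) k
  rw [MonoidHom.comp_apply, freeTwist_freeGen, freeTwist_freeGen, map_mul, map_inv,
    freeTwist_freeGen, freeTwist_freeGen, mul_assoc b c a]
  group

theorem freeTwist_one (k : FreeGroup I) : freeTwist ε (1 : A) k = k := by
  refine DFunLike.congr_fun (freeGroup_hom_ext_freeGen (g := MonoidHom.id _) ε fun a => ?_) k
  rw [freeTwist_freeGen, freeGen_one, one_mul, inv_one, mul_one]
  rfl

/-- The action of `A` on the free group on `A ∖ {1}` which corresponds to the conjugation by the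
first factor in the free product `A * A`. -/
noncomputable def freeTwistHom : A →* MulAut (FreeGroup I) where
  toFun b :=
    { toFun := freeTwist ε b
      invFun := freeTwist ε b⁻¹
      left_inv := fun k => by rw [← freeTwist_mul, inv_mul_cancel, freeTwist_one]
      right_inv := fun k => by rw [← freeTwist_mul, mul_inv_cancel, freeTwist_one]
      map_mul' := map_mul _ }
  map_one' := by ext1 k; exact freeTwist_one ε k
  map_mul' b c := by ext1 k; exact freeTwist_mul ε b c k

/-- The morphism `x_a ↦ a₁ a₂⁻¹` to the free product, where `a₁` and `a₂` are the two copies of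
`a`. -/
noncomputable def freeKernelHom : FreeGroup I →* Monoid.Coprod A A :=
  FreeGroup.lift fun i => .inl (ε i : A) * (.inr (ε i : A))⁻¹

theorem freeKernelHom_freeGen (a : A) :
    freeKernelHom ε (freeGen ε a) = .inl a * (.inr a)⁻¹ :=
  lift_freeGen ε (fun a : A => (Monoid.Coprod.inl a : Monoid.Coprod A A) * (Monoid.Coprod.inr a)⁻¹)
    (by simp) a

/-- The morphism from the free product to the semi-direct product `F ⋊ A`, where `F` is free on
`A ∖ {1}`. -/
noncomputable def toFreeSemidirect : Monoid.Coprod A A →* FreeGroup I ⋊[freeTwistHom ε] A :=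
  Monoid.Coprod.lift SemidirectProduct.inr
    { toFun := fun a => ⟨(freeGen ε a)⁻¹, a⟩
      map_one' := by
        rw [freeGen_one, inv_one]
        rfl
      map_mul' := fun a b => by
        refine SemidirectProduct.ext ?_ rfl
        change (freeGen ε (a * b))⁻¹ = (freeGen ε a)⁻¹ * freeTwist ε a (freeGen ε b)⁻¹
        rw [map_inv, freeTwist_freeGen]
        group }

theorem toFreeSemidirect_inl (a : A) :
    toFreeSemidirect ε (.inl a) = SemidirectProduct.inr a :=
  Monoid.Coprod.lift_apply_inl _ _ a

theorem toFreeSemidirect_inr (a : A) :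
    toFreeSemidirect ε (.inr a) = ⟨(freeGen ε a)⁻¹, a⟩ :=
  Monoid.Coprod.lift_apply_inr _ _ a

theorem toFreeSemidirect_freeKernelHom (k : FreeGroup I) :
    toFreeSemidirect ε (freeKernelHom ε k) = SemidirectProduct.inl k := by
  refine DFunLike.congr_fun (freeGroup_hom_ext_freeGen
    (f := (toFreeSemidirect ε).comp (freeKernelHom ε)) ε fun a => ?_) k
  rw [MonoidHom.comp_apply, freeKernelHom_freeGen, map_mul, map_inv, toFreeSemidirect_inl,
    toFreeSemidirect_inr, mul_inv_eq_iff_eq_mul]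
  refine SemidirectProduct.ext ?_ ?_
  · simp
  · simp

/-- The morphism `toFreeSemidirect` restricts to a left inverse of `freeKernelHom`. -/
theorem freeKernelHom_injective : Function.Injective (freeKernelHom ε) := by
  intro k k' h
  apply SemidirectProduct.inl_injective (φ := freeTwistHom ε)
  rw [← toFreeSemidirect_freeKernelHom, h, toFreeSemidirect_freeKernelHom]

/-- Conjugation by the first factor is given on the free generators by `x_a ↦ x_{ba} x_b⁻¹`. -/
theorem freeKernelHom_freeTwist (b : A) (k : FreeGroup I) :
    freeKernelHom ε (freeTwist ε b k) = .inl b * freeKernelHom ε k * (.inl b)⁻¹ := by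
  refine DFunLike.congr_fun (freeGroup_hom_ext_freeGen (f := (freeKernelHom ε).comp (freeTwist ε b))
    (g := (MulAut.conj (.inl b : Monoid.Coprod A A)).toMonoidHom.comp (freeKernelHom ε))
    ε fun a => ?_) k
  change freeKernelHom ε (freeTwist ε b _) = .inl b * freeKernelHom ε _ * (.inl b)⁻¹
  rw [freeTwist_freeGen, map_mul, map_inv, freeKernelHom_freeGen, freeKernelHom_freeGen,
    freeKernelHom_freeGen, map_mul, map_mul]
  group

/-- The fold map `A * A → A`, which is the identity on both factors. -/
def foldHom (A : Type*) [Group A] : Monoid.Coprod A A →* A :=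
  Monoid.Coprod.lift (MonoidHom.id A) (MonoidHom.id A)

theorem foldHom_inl (a : A) : foldHom A (.inl a) = a := Monoid.Coprod.lift_apply_inl _ _ a

theorem foldHom_inr (a : A) : foldHom A (.inr a) = a := Monoid.Coprod.lift_apply_inr _ _ a

theorem foldHom_freeKernelHom (k : FreeGroup I) : foldHom A (freeKernelHom ε k) = 1 := by
  refine DFunLike.congr_fun (freeGroup_hom_ext_freeGen (g := 1)
    (f := (foldHom A).comp (freeKernelHom ε)) ε fun a => ?_) k
  rw [MonoidHom.comp_apply, freeKernelHom_freeGen, map_mul, map_inv, foldHom_inl, foldHom_inr,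
    mul_inv_cancel]
  rfl

/-- The free product is the product of the free group on `A ∖ {1}` and of its first factor. -/
theorem exists_eq_freeKernelHom_mul (p : Monoid.Coprod A A) :
    ∃ k, p = freeKernelHom ε k * .inl (foldHom A p) := by
  induction p using Monoid.Coprod.induction_on with
  | inl a => exact ⟨1, by rw [map_one, one_mul, foldHom_inl]⟩
  | inr a =>
    refine ⟨(freeGen ε a)⁻¹, ?_⟩
    rw [map_inv, freeKernelHom_freeGen, foldHom_inr]
    group
  | mul p q hp hq =>
    obtain ⟨k, hk⟩ := hp
    obtain ⟨l, hl⟩ := hq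
    refine ⟨k * freeTwist ε (foldHom A p) l, ?_⟩
    rw [map_mul, map_mul, map_mul, freeKernelHom_freeTwist]
    conv_lhs => rw [hk, hl]
    group

theorem exists_freeKernelHom_eq {p : Monoid.Coprod A A} (hp : foldHom A p = 1) :
    ∃ k, freeKernelHom ε k = p := by
  obtain ⟨k, hk⟩ := exists_eq_freeKernelHom_mul ε p
  rw [hp, map_one, mul_one] at hk
  exact ⟨k, hk.symm⟩

/-- The kernel of the fold map acts simply transitively on the cosets of a subgroup which is mapped
isomorphically by the fold map. -/
theorem freeKernelHom_mk_bijective (j : A →* Monoid.Coprod A A) (hj : ∀ a, foldHom A (j a) = a) :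
    Function.Bijective fun k => (freeKernelHom ε k : Monoid.Coprod A A ⧸ j.range) := by
  constructor
  · intro k l h
    obtain ⟨a, ha⟩ := QuotientGroup.eq.1 h
    have h1 := congrArg (foldHom A) ha
    rw [hj, map_mul, map_inv, foldHom_freeKernelHom, foldHom_freeKernelHom, inv_one,
      one_mul] at h1
    rw [h1, map_one] at ha
    exact freeKernelHom_injective ε (inv_mul_eq_one.1 ha.symm)
  · intro x
    obtain ⟨p, rfl⟩ := QuotientGroup.mk_surjective x
    obtain ⟨k, hk⟩ := exists_freeKernelHom_eq ε (p := p * (j (foldHom A p))⁻¹) (by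
      rw [map_mul, map_inv, hj, mul_inv_cancel])
    refine ⟨k, QuotientGroup.eq.2 ⟨foldHom A p, ?_⟩⟩
    rw [hk]
    group

end FreeKernel

section WreathDecomposition

variable {A I B : Type*} [Group A] [Group B] (ε : I ≃ {a : A // a ≠ 1})

/-- The vertices of the Bass-Serre tree of `A * A` consist of two copies of the free kernel of the
fold map. -/
noncomputable def kernelVertexEquiv (j : A →* Monoid.Coprod A A) (hj : ∀ a, foldHom A (j a) = a) :
    FreeGroup I ≃ Monoid.Coprod A A ⧸ j.range :=
  Equiv.ofBijective _ (freeKernelHom_mk_bijective ε j hj)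

theorem kernelVertexEquiv_symm_smul (j : A →* Monoid.Coprod A A) (hj : ∀ a, foldHom A (j a) = a)
    (k : FreeGroup I) (x : Monoid.Coprod A A ⧸ j.range) :
    (kernelVertexEquiv ε j hj).symm ((freeKernelHom ε k)⁻¹ • x) =
      k⁻¹ * (kernelVertexEquiv ε j hj).symm x := by
  obtain ⟨l, rfl⟩ := (kernelVertexEquiv ε j hj).surjective x
  rw [Equiv.symm_apply_eq, Equiv.symm_apply_apply]
  change (((freeKernelHom ε k)⁻¹ * freeKernelHom ε l : Monoid.Coprod A A) : _ ⧸ j.range) =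
    (freeKernelHom ε (k⁻¹ * l) : Monoid.Coprod A A)
  rw [map_mul, map_inv]

/-- The embedding of `(B × B) ≀ F` into `B ≀ (A * A)`, where `F` is the free kernel of the fold
map: the two components of a lamp are placed on the two orbits of `F` on the vertices. -/
noncomputable def lampKernelHom :
    RestrictedWreath (B × B) (FreeGroup I) (FreeGroup I) →*
      RestrictedWreath B
        ((Monoid.Coprod A A ⧸ (Monoid.Coprod.inl : A →* Monoid.Coprod A A).range) ⊕
          (Monoid.Coprod A A ⧸ (Monoid.Coprod.inr : A →* Monoid.Coprod A A).range))
        (Monoid.Coprod A A) where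
  toFun x := ⟨⟨Sum.elim
      (fun v => (x.left ((kernelVertexEquiv ε _ foldHom_inl).symm v)).1)
      (fun v => (x.left ((kernelVertexEquiv ε _ foldHom_inr).symm v)).2), by
    have hx : {k | ¬ x.left k ∈ (⊥ : Subgroup (B × B))}.Finite := x.left.2
    refine ((hx.image fun k => Sum.inl (kernelVertexEquiv ε _ foldHom_inl k)).union
      (hx.image fun k => Sum.inr (kernelVertexEquiv ε _ foldHom_inr k))).subset ?_
    rintro (v | v) hv
    · refine Or.inl ⟨(kernelVertexEquiv ε _ foldHom_inl).symm v, fun hcon => hv ?_, by simp⟩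
      exact congrArg Prod.fst (Subgroup.mem_bot.1 hcon)
    · refine Or.inr ⟨(kernelVertexEquiv ε _ foldHom_inr).symm v, fun hcon => hv ?_, by simp⟩
      exact congrArg Prod.snd (Subgroup.mem_bot.1 hcon)⟩, freeKernelHom ε x.right⟩
  map_one' := by
    refine SemidirectProduct.ext ?_ (map_one _)
    ext (v | v) <;> rfl
  map_mul' x y := by
    refine SemidirectProduct.ext ?_ (map_mul _ _ _)
    ext (v | v)
    · change (x.left _ * y.left (x.right⁻¹ * _)).1 = (x.left _).1 *
        (y.left ((kernelVertexEquiv ε _ foldHom_inl).symm ((freeKernelHom ε x.right)⁻¹ • v))).1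
      rw [kernelVertexEquiv_symm_smul]
      rfl
    · change (x.left _ * y.left (x.right⁻¹ * _)).2 = (x.left _).2 *
        (y.left ((kernelVertexEquiv ε _ foldHom_inr).symm ((freeKernelHom ε x.right)⁻¹ • v))).2
      rw [kernelVertexEquiv_symm_smul]
      rfl

theorem lampKernelHom_left_inl (x : RestrictedWreath (B × B) (FreeGroup I) (FreeGroup I))
    (k : FreeGroup I) : (lampKernelHom (B := B) ε x).left
      (.inl (kernelVertexEquiv ε _ foldHom_inl k)) = (x.left k).1 :=
  congrArg (fun k => (x.left k).1) (Equiv.symm_apply_apply _ k)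

theorem lampKernelHom_left_inr (x : RestrictedWreath (B × B) (FreeGroup I) (FreeGroup I))
    (k : FreeGroup I) : (lampKernelHom (B := B) ε x).left
      (.inr (kernelVertexEquiv ε _ foldHom_inr k)) = (x.left k).2 :=
  congrArg (fun k => (x.left k).2) (Equiv.symm_apply_apply _ k)

theorem lampKernelHom_injective : Function.Injective (lampKernelHom (B := B) ε) := by
  intro x y h
  refine SemidirectProduct.ext ?_
    (freeKernelHom_injective ε (congrArg SemidirectProduct.right h))
  ext k : 1
  refine Prod.ext ?_ ?_
  · rw [← lampKernelHom_left_inl ε x, h, lampKernelHom_left_inl]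
  · rw [← lampKernelHom_left_inr ε x, h, lampKernelHom_left_inr]

/-- The image of `(B × B) ≀ F` is the kernel of `B ≀ (A * A) → A * A → A`. -/
theorem range_lampKernelHom :
    (lampKernelHom (B := B) ε).range = ((foldHom A).comp SemidirectProduct.rightHom).ker := by
  ext x
  rw [MonoidHom.mem_ker]
  constructor
  · rintro ⟨y, rfl⟩
    exact foldHom_freeKernelHom ε y.right
  · intro hx
    obtain ⟨k, hk⟩ := exists_freeKernelHom_eq ε (p := x.right) hx
    refine ⟨⟨⟨fun l => (x.left (.inl (kernelVertexEquiv ε _ foldHom_inl l)),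
      x.left (.inr (kernelVertexEquiv ε _ foldHom_inr l))), ?_⟩, k⟩,
        SemidirectProduct.ext ?_ hk⟩
    · have h1 := (Sum.inl_injective.comp
        (kernelVertexEquiv ε _ foldHom_inl).injective).tendsto_cofinite.eventually x.left.2
      have h2 := (Sum.inr_injective.comp
        (kernelVertexEquiv ε _ foldHom_inr).injective).tendsto_cofinite.eventually x.left.2
      filter_upwards [h1, h2] with l hl1 hl2
      exact Subgroup.mem_bot.2 (Prod.ext (Subgroup.mem_bot.1 hl1) (Subgroup.mem_bot.1 hl2))
    · ext (v | v)
      · obtain ⟨l, rfl⟩ := (kernelVertexEquiv ε _ foldHom_inl).surjective v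
        exact lampKernelHom_left_inl ε _ l
      · obtain ⟨l, rfl⟩ := (kernelVertexEquiv ε _ foldHom_inr).surjective v
        exact lampKernelHom_left_inr ε _ l

end WreathDecomposition

/-- The group `C_n ≀_V (C_d * C_d)` is a semi-direct product `(C_n² ≀ 𝔽_{d-1}) ⋊ C_d`. -/
theorem exists_lampCyclicGroup_mulEquiv (d n : ℕ) [NeZero d] :
    ∃ θ : CyclicGrp d →* MulAut (LampFreeGroup n (d - 1)),
      Nonempty (LampCyclicGroup n d ≃* LampFreeGroup n (d - 1) ⋊[θ] CyclicGrp d) := by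
  classical
  have hcard : Fintype.card {a : CyclicGrp d // a ≠ 1} = d - 1 := by
    rw [Fintype.card_subtype_compl, Fintype.card_subtype_eq]
    congr 1
    exact (Fintype.card_congr Multiplicative.toAdd).trans (ZMod.card d)
  let ε : Fin (d - 1) ≃ {a : CyclicGrp d // a ≠ 1} := (Fintype.equivFinOfCardEq hcard).symm
  exact exists_mulEquiv_semidirectProduct (lampKernelHom_injective (B := CyclicGrp n) ε)
    (SemidirectProduct.inr.comp Monoid.Coprod.inl) (fun q => foldHom_inl q) (range_lampKernelHom ε)

theorem theorem2p5 {V Ω : Type*} [Fintype Ω] (d n : ℕ) [NeZero n] (hd : 3 ≤ d)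
    (hΩ : Fintype.card Ω = d)
    (T : SimpleGraph V) (hT : T.IsTree) (c : LegalColoring T Ω)
    (F F' : Subgroup (Equiv.Perm Ω)) (hFF' : F < F')
    (hF : IsSemiregularPermGroup F) (horb : PreservesOrbitsOf F' F)
    (hn : F.relIndex F' = n) :
    (∀ e : (F' ⧸ F.subgroupOf F') ≃ Fin n, e ((1 : F') : F' ⧸ F.subgroupOf F') = 0 →
      ∃ φ : c.almostPrescribed F F' →* LampGroup n T,
        (∀ γ, (∀ v, (φ γ).left v = c.cocycle e γ v) ∧ (φ γ).right = γ) ∧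
        Function.Injective φ ∧
        IsCocompactLattice φ.range ∧
        IsIrreducibleInWreath φ.range ∧
        ∃ ψ : c.almostPrescribed F F' →* (lamplighterGraph n T ≃g lamplighterGraph n T),
          (∀ γ f v, (∀ w, (ψ γ (f, v)).1 w = (φ γ).left w (f ((γ : T ≃g T)⁻¹ w))) ∧
            (ψ γ (f, v)).2 = (γ : T ≃g T) v) ∧
          IsProperGraphAction ψ ∧
          IsCocompactGraphAction ψ) ∧
    (IsRegularPermGroup F →
      HaveIsometricCayleyGraphs (LampCyclicGroup n d) (c.almostPrescribedStar F F')) ∧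
    (∃ θ : CyclicGrp d →* MulAut (LampFreeGroup n (d - 1)),
      Nonempty (LampCyclicGroup n d ≃* LampFreeGroup n (d - 1) ⋊[θ] CyclicGrp d)) := by
  have hpos : 0 < Fintype.card Ω := by lia
  have : Nonempty Ω := Fintype.card_pos_iff.1 hpos
  have : NeZero d := ⟨by lia⟩
  have hn2 : 2 ≤ n := by
    have h1 : n ≠ 1 := fun h => hFF'.not_ge (Subgroup.relIndex_eq_one.1 (hn.trans h))
    have h0 : n ≠ 0 := NeZero.ne n
    lia
  refine ⟨fun e he => ⟨c.twist e he, fun γ => ⟨fun v => rfl, rfl⟩, c.twist_injective e he,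
    c.isCocompactLattice_twist e he hT hFF'.le hF horb,
    c.isIrreducible_twist e he (by lia) hn2 hT hFF'.le horb,
    (lamplighterHom n T).comp (c.twist e he), fun γ f v => ⟨fun w => ?_, rfl⟩,
    c.isProperGraphAction_twist e he hT hFF'.le hF horb,
    c.isCocompactGraphAction_twist e he hT hFF'.le horb⟩, fun hreg => ?_,
    exists_lampCyclicGroup_mulEquiv d n⟩
  · exact lampPerm_apply (c.twist e he γ) f w
  · have hcard : Nat.card (F' ⧸ F.subgroupOf F') = n := hn
    have : Finite (F' ⧸ F.subgroupOf F') :=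
      Nat.finite_of_card_ne_zero (by rw [hcard]; exact NeZero.ne n)
    let e₀ : (F' ⧸ F.subgroupOf F') ≃ Fin n := Finite.equivFinOfCardEq hcard
    -- Any numbering of the cosets, corrected so that the coset `F` gets the number `0`.
    let e := e₀.trans (Equiv.swap (e₀ ((1 : F') : F' ⧸ F.subgroupOf F')) 0)
    exact c.haveIsometricCayleyGraphs_almostPrescribedStar hd hΩ hT hFF'.le hreg horb e
      (Equiv.swap_apply_left _ _)
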